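/- **Proposition (coordinate expression of Bethe vectors).** *Setting.* For $a,b\in\{0,1\}$ and $\Im\tau>0$ put $\theta_{ab}(z;\tau)=\sum_{n\in\mathbb Z}\exp\big(\pi i(\tfrac a2+n)^2\tau+2\pi i(\tfrac a2+n)(\tfrac b2+z)\big)$. Let $t>0$, $\tau=i/t$, and write $\theta_{ab}(z)=\theta_{ab}(z;\tau)$. Let $\eta=r'/r$, where $r>2$ is an even integer, $r'$ is an odd integer, and $r,r'$ are coprime. Let $\ell\in\tfrac12\mathbb Z_{\ge0}$ and let $N\ge0$ be an integer such that $M:=N\ell$ is an integer. Let $V$ be the space of entire functions $f$ with $f(z+1)=f(-z)=f(z)$ and $f(z+\tau)=e^{-4\ell\pi i(2z+\tau)}f(z)$. For $a=0,1,2,3$ let $S^a$ act on $V$ by $$(S^af)(z)=\frac{s_a(z-\ell\eta)f(z+\eta)-s_a(-z-\ell\eta)f(z-\eta)}{\theta_{11}(2z)},$$ where $s_0(z)=\theta_{11}(\eta)\theta_{11}(2z)$, $s_1(z)=\theta_{10}(\eta)\theta_{10}(2z)$, $s_2(z)=i\,\theta_{00}(\eta)\theta_{00}(2z)$, $s_3(z)=\theta_{01}(\eta)\theta_{01}(2z)$.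 On $\mathcal H=V_N\otimes\dots\otimes V_1$ with all $V_n=V$ put $$L_n(\lambda)=\sum_{a=0}^3W^L_a(\lambda)\,S^a_n\otimes\sigma^a,\qquad (W^L_0,W^L_1,W^L_2,W^L_3)(\lambda)=\Big(\tfrac{\theta_{11}(\lambda)}{\theta_{11}(\eta)},\tfrac{\theta_{10}(\lambda)}{\theta_{10}(\eta)},\tfrac{\theta_{00}(\lambda)}{\theta_{00}(\eta)},\tfrac{\theta_{01}(\lambda)}{\theta_{01}(\eta)}\Big),$$ where $S^a_n$ acts on $V_n$, $\sigma^0=1$, and $\sigma^1,\sigma^2,\sigma^3$ are the Pauli matrices. This is a $2\times2$ matrix of operators on $\mathcal H$. Put $\mathcal T(\lambda)=L_N(\lambda)\cdots L_1(\lambda)$. Fix $s=(s_+,s_-)\in\mathbb C^2$, let $w_k=\frac{s_++s_-}2+2k\eta-\frac\tau2$, write $x_k=s_+-\lambda+2k\eta$, $y_k=s_-+\lambda+2k\eta$, and let $$M_k(\lambda)=\begin{pmatrix}\theta_{11}(-itx_k;2it)&\theta_{11}(-ity_k;2it)\\ \theta_{01}(-itx_k;2it)&\theta_{01}(-ity_k;2it)\end{pmatrix}\begin{pmatrix}e^{-\frac{\pi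 t}2(x_k-\frac i{2t})^2}&0\\0&e^{-\frac{\pi t}2(y_k-\frac i{2t})^2}\end{pmatrix}\begin{pmatrix}1&0\\0&\theta_{11}(w_k)^{-1}\end{pmatrix}.$$ Let $B_{k,k'}(\lambda)$ be the $(1,2)$ entry of $M_k(\lambda)^{-1}\mathcal T(\lambda)M_{k'}(\lambda)$. For integers $k,k'$ with $k-k'\in\{-2\ell,-2\ell+2,\dots,2\ell\}$ let $\phi_{k,k'}\in V$ be the intertwining vector $$\phi_{k,k'}(z)=a_{k,k'}\prod_{j=1}^{\ell+\frac{k-k'}2}\theta_{00}(z+u_j)\theta_{00}(z-u_j)\prod_{j=1}^{\ell-\frac{k-k'}2}\theta_{00}(z+v_j)\theta_{00}(z-v_j),$$ $$u_j=\tfrac{s_+}2+\tfrac\tau4+(k'-\ell+2j-1)\eta,\quad v_j=\tfrac{s_-}2+\tfrac\tau4+(k-\ell+2j-1)\eta,\quad a_{k,k'}=e^{2\pi i\ell(k+k')\eta}\big(-e^{\pi i(s_+-s_-)}\big)^{\frac{k-k'}2}$$ (principal branch of the power). The fundamental vectors are $|a_N,\dots,a_1,a_0\rangle=\phi_{a_N,a_{N-1}}\otimes\dots\otimes\phi_{a_1,a_0}$,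 and $\Omega^a_N=|a+2N\ell,\dots,a+2\ell,a\rangle$. For $\nu\in\mathbb Z$ and $\lambda_1,\dots,\lambda_M\in\mathbb C$ the Bethe vector is $$\Psi_\nu(\lambda_1,\dots,\lambda_M)=\sum_{a=0}^{r-1}e^{2\pi i\nu\eta a}B_{a+1,a-1}(\lambda_1)B_{a+2,a-2}(\lambda_2)\cdots B_{a+M,a-M}(\lambda_M)\,\Omega^{a-M}_N .$$ The SOS face weights, with $W(k,k';m,m'|\lambda)$ attached to $k,k'$ and $m=k\pm1$, $m'=k'\pm1$, are $$W(k,k';k-1,k'-1|\lambda)=2\theta_{11}(\lambda+(k-k')\eta)\tfrac{\theta_{11}(w_{(k+k'+2\ell)/2})}{\theta_{11}(w_k)},\qquad W(k,k';k-1,k'+1|\lambda)=2\theta_{11}((k'-k-2\ell)\eta)\tfrac{\theta_{11}(w_{(k+k')/2}+\lambda)}{\theta_{11}(w_k)\theta_{11}(w_{k'})},$$ $$W(k,k';k+1,k'-1|\lambda)=2\theta_{11}((k-k'-2\ell)\eta)\,\theta_{11}(w_{(k+k')/2}-\lambda),\qquad W(k,k';k+1,k'+1|\lambda)=2\theta_{11}(\lambda-(k-k')\eta)\tfrac{\theta_{11}(w_{(k+k'-2\ell)/2})}{\theta_{11}(w_{k'})}.$$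 *Statement.* Assume that the objects above are defined, i.e. $\theta_{11}(w_k)\ne0$ and $M_k(\lambda_i)$ is invertible for all $k\in\mathbb Z$ and $1\le i\le M$. The Bethe equations are not assumed. Then $$\Psi_\nu(\lambda_1,\dots,\lambda_M)=\sum_{a=0}^{r-1}e^{2\pi i\nu\eta a}\sum_{a_0=a,\,a_1,\dots,a_{N-1},\,a_N=a}\Big(\sum_{\{a_{i,j}\}}\prod_{i=1}^M\prod_{j=1}^NW(a_{i,j},a_{i,j-1};a_{i-1,j},a_{i-1,j-1}|\lambda_i)\Big)|a_N,\dots,a_1,a_0\rangle .$$ The second sum runs over integers $a_j$ with $a_j-a_{j-1}\in\{-2\ell,-2\ell+2,\dots,2\ell\}$. The sum in parentheses runs over all families of integers $a_{i,j}$ ($0\le i\le M$, $0\le j\le N$) satisfying $a_{i,j}-a_{i-1,j}=\pm1$, $a_{i,j}-a_{i,j-1}\in\{-2\ell,-2\ell+2,\dots,2\ell\}$, and the boundary conditions $a_{0,j}=a_j$, $a_{M,j}=a-N\ell+2\ell j$, $a_{i,0}=a-i$, $a_{i,N}=a+i$. Both sums are finite. -/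

import Mathlib

open Complex
open scoped Real TensorProduct

namespace EightVertex
noncomputable section

/-- The theta function `θ_{ab}(z; τ)` with characteristics `a, b ∈ {0, 1}`. -/
def theta (a b : ℕ) (z τ : ℂ) : ℂ :=
  ∑' n : ℤ, cexp (π * I * ((a : ℂ) / 2 + n) ^ 2 * τ
    + 2 * π * I * ((a : ℂ) / 2 + n) * ((b : ℂ) / 2 + z))

/-- The space `Θ^{2L+}_{00}` (that is, `Θ^{4ℓ+}_{00}` with `L = 2ℓ`): entire functions `f` with
`f(z+1) = f(-z) = f(z)` and `f(z+τ) = exp(-2Lπi(2z+τ)) f(z)`. -/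
def evenTheta (τ : ℂ) (L : ℕ) : Submodule ℂ (ℂ → ℂ) where
  carrier := {f | Differentiable ℂ f ∧ (∀ z, f (z + 1) = f z) ∧ (∀ z, f (-z) = f z) ∧
    ∀ z, f (z + τ) = cexp (-(2 * L * π * I * (2 * z + τ))) * f z}
  add_mem' := by
    rintro f g ⟨h1, h2, h3, h4⟩ ⟨k1, k2, k3, k4⟩
    refine ⟨h1.add k1, fun z => ?_, fun z => ?_, fun z => ?_⟩
    · simp [h2, k2]
    · simp [h3, k3]
    · simp [h4, k4, mul_add]
  zero_mem' := by
    refine ⟨differentiable_const 0, fun z => ?_, fun z => ?_, fun z => ?_⟩ <;> simp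
  smul_mem' := by
    rintro c f ⟨h1, h2, h3, h4⟩
    refine ⟨h1.const_smul c, fun z => ?_, fun z => ?_, fun z => ?_⟩
    · simp [h2]
    · simp [h3]
    · simp only [Pi.smul_apply, smul_eq_mul, h4]; ring

/-- The odd analogue of `evenTheta`; it is only used to show that the operators of the spin `ℓ`
representation preserve `evenTheta`. -/
def oddTheta (τ : ℂ) (L : ℕ) : Submodule ℂ (ℂ → ℂ) where
  carrier := {f | Differentiable ℂ f ∧ (∀ z, f (z + 1) = f z) ∧ (∀ z, f (-z) = -f z) ∧
    ∀ z, f (z + τ) = cexp (-(2 * L * π * I * (2 * z + τ))) * f z}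
  add_mem' := by
    rintro f g ⟨h1, h2, h3, h4⟩ ⟨k1, k2, k3, k4⟩
    refine ⟨h1.add k1, fun z => ?_, fun z => ?_, fun z => ?_⟩
    · simp [h2, k2]
    · simp [h3, k3]; ring
    · simp [h4, k4, mul_add]
  zero_mem' := by
    refine ⟨differentiable_const 0, fun z => ?_, fun z => ?_, fun z => ?_⟩ <;> simp
  smul_mem' := by
    rintro c f ⟨h1, h2, h3, h4⟩
    refine ⟨h1.const_smul c, fun z => ?_, fun z => ?_, fun z => ?_⟩
    · simp [h2]
    · simp [h3]
    · simp only [Pi.smul_apply, smul_eq_mul, h4]; ring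

theorem theta_eq (a b : ℕ) (z τ : ℂ) :
    theta a b z τ = cexp (π * I * (a : ℂ) ^ 2 / 4 * τ + π * I * a * ((b : ℂ) / 2 + z)) *
      jacobiTheta₂ (z + (b : ℂ) / 2 + (a : ℂ) / 2 * τ) τ := by
  rw [theta, jacobiTheta₂, ← tsum_mul_left]
  refine tsum_congr fun n => ?_
  rw [jacobiTheta₂_term, ← Complex.exp_add]
  congr 1; ring

theorem theta_differentiable (a b : ℕ) {τ : ℂ} (hτ : 0 < τ.im) :
    Differentiable ℂ fun z => theta a b z τ := by
  have h : Differentiable ℂ fun z => jacobiTheta₂ z τ := fun z =>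
    differentiableAt_jacobiTheta₂_fst z hτ
  simp only [theta_eq]
  have h2 : Differentiable ℂ fun z : ℂ => z + (b : ℂ) / 2 + (a : ℂ) / 2 * τ := by fun_prop
  exact Differentiable.mul (by fun_prop) (h.comp h2)

theorem theta_add_two (a b : ℕ) (z τ : ℂ) : theta a b (z + 2) τ = theta a b z τ := by
  unfold theta
  refine tsum_congr fun n => ?_
  rw [Complex.exp_eq_exp_iff_exists_int]
  refine ⟨a + 2 * n, ?_⟩
  push_cast; ring

theorem theta_add_two_mul (a b : ℕ) (z τ : ℂ) :
    theta a b (z + 2 * τ) τ = cexp (-(4 * π * I * (z + τ))) * theta a b z τ := by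
  unfold theta
  rw [← tsum_mul_left, ← (Equiv.addRight (-2 : ℤ)).tsum_eq]
  refine tsum_congr fun n => ?_
  rw [← Complex.exp_add, Complex.exp_eq_exp_iff_exists_int]
  refine ⟨-b, ?_⟩
  simp only [Equiv.coe_addRight]
  push_cast; ring

theorem theta_one_one_neg (z τ : ℂ) : theta 1 1 (-z) τ = -theta 1 1 z τ := by
  unfold theta
  rw [← tsum_neg, ← (Equiv.subLeft (-1 : ℤ)).tsum_eq]
  refine tsum_congr fun n => ?_
  have : ∀ w : ℂ, -cexp w = cexp (w + π * I) := fun w => by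
    rw [Complex.exp_add, Complex.exp_pi_mul_I]; ring
  rw [this, Complex.exp_eq_exp_iff_exists_int]
  refine ⟨-n - 1, ?_⟩
  simp only [Equiv.subLeft_apply]
  push_cast; ring

theorem theta_zero_zero_neg (z τ : ℂ) : theta 0 0 (-z) τ = theta 0 0 z τ := by
  simp [theta_eq, jacobiTheta₂_neg_left]

theorem theta_zero_zero_add_one (z τ : ℂ) : theta 0 0 (z + 1) τ = theta 0 0 z τ := by
  simp [theta_eq, jacobiTheta₂_add_left]

theorem theta_zero_zero_add (z τ : ℂ) :
    theta 0 0 (z + τ) τ = cexp (-(π * I * (2 * z + τ))) * theta 0 0 z τ := by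
  simp only [theta_eq, Nat.cast_zero]
  simp [jacobiTheta₂_add_left']
  left; congr 1; ring

theorem jacobiTheta₂_imag_ne_zero (x : ℝ) {t : ℝ} (ht : 0 < t) :
    jacobiTheta₂ (x * I) (t * I) ≠ 0 := by
  have h := hasSum_jacobiTheta₂_term (x * I) (τ := t * I) (by simpa using ht)
  have hterm : ∀ n : ℤ, jacobiTheta₂_term n (x * I) (t * I) =
      ((Real.exp (-(2 * π * n * x + π * n ^ 2 * t)) : ℝ) : ℂ) := by
    intro n
    rw [jacobiTheta₂_term]
    push_cast
    congr 1
    linear_combination (2 * π * n * x + π * n ^ 2 * t : ℂ) * I_mul_I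
  simp only [hterm] at h
  have hs := Complex.summable_ofReal.1 h.summable
  have h2 := (Complex.hasSum_ofReal.2 hs.hasSum).unique h
  rw [← h2]
  rw [Complex.ofReal_ne_zero]
  exact (hs.tsum_pos (fun n => (Real.exp_pos _).le) 0 (Real.exp_pos _)).ne'

/-- Fourier coefficients on `[0, 1]`. -/
def fc (f : ℂ → ℂ) (m : ℤ) : ℂ := ∫ x in (0 : ℝ)..1, f x * cexp (-(2 * π * I * m * x))

theorem eq_zero_of_fc {f : ℂ → ℂ} (hf : Differentiable ℂ f) (h1 : ∀ z, f (z + 1) = f z)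
    (hc : ∀ m, fc f m = 0) : f = 0 := by
  have : Fact ((0 : ℝ) < 1) := ⟨one_pos⟩
  have hper : Function.Periodic (fun x : ℝ => f x) 1 := fun x => by
    have := h1 x; simpa using this
  have hcont : Continuous (fun x : ℝ => f x) := hf.continuous.comp Complex.continuous_ofReal
  let g : C(AddCircle (1 : ℝ), ℂ) := ⟨hper.lift, by
    exact continuous_coinduced_dom.mpr hcont⟩
  have hg : ∀ m, fourierCoeff g m = 0 := by
    intro m
    rw [fourierCoeff_eq_intervalIntegral _ _ 0, ← hc m, fc, div_one, one_smul, zero_add]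
    refine intervalIntegral.integral_congr fun x _ => ?_
    rw [fourier_coe_apply]
    have : g (x : AddCircle (1 : ℝ)) = f x := hper.lift_coe x
    simp only [this, smul_eq_mul]
    rw [mul_comm]
    congr 2
    push_cast; ring
  have hsum : Summable (fourierCoeff g) := by
    have : fourierCoeff g = 0 := funext hg
    rw [this]; exact summable_zero
  have hzero : ∀ x : ℝ, f x = 0 := by
    intro x
    have h := has_pointwise_sum_fourier_series_of_summable hsum (x : AddCircle (1 : ℝ))
    simp only [hg, zero_smul] at h
    have h3 := h.unique hasSum_zero
    have : g (x : AddCircle (1 : ℝ)) = f x := hper.lift_coe x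
    rw [← this, h3]
  have ha : AnalyticOnNhd ℂ f Set.univ := hf.differentiableOn.analyticOnNhd isOpen_univ
  have h0 : AnalyticOnNhd ℂ (0 : ℂ → ℂ) Set.univ := fun _ _ => analyticAt_const
  refine AnalyticOnNhd.eq_of_frequently_eq ha h0 (z₀ := 0) ?_
  rw [Filter.frequently_iff]
  intro U hU
  rw [Metric.mem_nhdsWithin_iff] at hU
  obtain ⟨ε, hε, hU⟩ := hU
  refine ⟨((ε / 2 : ℝ) : ℂ), hU ⟨?_, ?_⟩, hzero _⟩
  · simp only [Metric.mem_ball, dist_zero_right, Complex.norm_real, Real.norm_eq_abs]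
    rw [abs_of_pos (by positivity)]; linarith
  · simp; positivity

theorem fc_neg {f : ℂ → ℂ} (h1 : ∀ z, f (z + 1) = f z) (h2 : ∀ z, f (-z) = -f z) (m : ℤ) :
    fc f (-m) = -fc f m := by
  have h := intervalIntegral.integral_comp_sub_left
    (fun x : ℝ => f x * cexp (-(2 * π * I * (-m : ℤ) * x))) (1 : ℝ) (a := 0) (b := 1)
  simp only [sub_self, sub_zero] at h
  unfold fc
  rw [← h, ← intervalIntegral.integral_neg]
  refine intervalIntegral.integral_congr fun x _ => ?_
  have e1 : f ((1 - x : ℝ) : ℂ) = -f x := by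
    rw [← h2, ← h1 (-x)]; congr 1; push_cast; ring
  simp only [e1]
  rw [neg_mul]
  congr 2
  rw [Complex.exp_eq_exp_iff_exists_int]
  exact ⟨m, by push_cast; ring⟩

theorem fc_add {f : ℂ → ℂ} {t : ℝ} {L : ℕ} (hf : Differentiable ℂ f)
    (h1 : ∀ z, f (z + 1) = f z)
    (h4 : ∀ z, f (z + t * I) = cexp (-(2 * L * π * I * (2 * z + t * I))) * f z) (m : ℤ) :
    fc f m = cexp (-(2 * π * I * (L + m) * (t * I))) * fc f (m + 2 * L) := by
  let h : ℂ → ℂ := fun z => f z * cexp (-(2 * π * I * m * z))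
  have hd : Differentiable ℂ h := hf.mul (by fun_prop)
  have hp : ∀ z, h (z + 1) = h z := by
    intro z
    simp only [h, h1]
    congr 1
    rw [Complex.exp_eq_exp_iff_exists_int]
    exact ⟨-m, by push_cast; ring⟩
  have key := Complex.integral_boundary_rect_eq_zero_of_differentiableOn h 0 (1 + t * I)
    hd.differentiableOn
  simp only [zero_im, zero_re, add_re, one_re, mul_re, ofReal_re, I_re, mul_zero, ofReal_im,
    I_im, mul_one, sub_self, add_zero, add_im, one_im, mul_im, zero_add, ofReal_zero, zero_mul,
    ofReal_one] at key
  have hv : (fun y : ℝ => h (1 + y * I)) = fun y : ℝ => h (y * I) := by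
    funext y; rw [add_comm, hp]
  rw [hv] at key
  have key2 : (∫ x in (0 : ℝ)..1, h x) = ∫ x in (0 : ℝ)..1, h (x + t * I) := by
    linear_combination key
  have : fc f m = ∫ x in (0 : ℝ)..1, h x := rfl
  rw [this, key2, fc, ← intervalIntegral.integral_const_mul]
  refine intervalIntegral.integral_congr fun x _ => ?_
  simp only [h, h4]
  have : ∀ A B C D y : ℂ, A + B = C + D → cexp A * y * cexp B = cexp C * (y * cexp D) := by
    intro A B C D y e
    have := congrArg cexp e
    rw [Complex.exp_add, Complex.exp_add] at this
    linear_combination y * this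
  apply this
  push_cast; ring

theorem odd_eq_zero {t : ℝ} {L : ℕ} {f : ℂ → ℂ} (hf : f ∈ oddTheta (t * I) (L + 2))
    (hc : ∀ m : Fin (L + 1), fc f (m + 1) = 0) : f = 0 := by
  obtain ⟨h1, h2, h3, h4⟩ := hf
  have hneg : ∀ m, fc f m = 0 → fc f (-m) = 0 := fun m hm => by
    rw [fc_neg h2 h3, hm, neg_zero]
  have hadd := fc_add h1 h2 h4
  have hup : ∀ m, fc f m = 0 ↔ fc f (m + 2 * (L + 2 : ℕ)) = 0 := fun m => by
    rw [hadd m]; simp [Complex.exp_ne_zero]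
  have hzero : fc f 0 = 0 := by
    have := fc_neg h2 h3 0
    rw [neg_zero] at this
    linear_combination (1 / 2 : ℂ) * this
  have hD : fc f (L + 2 : ℕ) = 0 := by
    have e1 := hadd (-(L + 2 : ℕ))
    rw [fc_neg h2 h3, show (-((L + 2 : ℕ) : ℤ) + 2 * ((L + 2 : ℕ) : ℤ)) = (L + 2 : ℕ) by ring] at e1
    have : (-(2 * π * I * (((L + 2 : ℕ) : ℂ) + ((-((L + 2 : ℕ) : ℤ) : ℤ) : ℂ)) * (t * I))) = 0 := by
      push_cast; ring
    rw [this, Complex.exp_zero, one_mul] at e1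
    linear_combination (-1 / 2 : ℂ) * e1
  have hsmall : ∀ n : ℕ, n ≤ L + 2 → fc f n = 0 := by
    intro n hn
    rcases Nat.eq_zero_or_pos n with rfl | hpos
    · exact hzero
    rcases Nat.lt_or_ge n (L + 2) with hlt | hge
    · have := hc ⟨n - 1, by omega⟩
      have e : ((n - 1 : ℕ) : ℤ) + 1 = n := by omega
      simpa [e] using this
    · obtain rfl : n = L + 2 := by omega
      exact hD
  have hnat : ∀ n : ℕ, fc f n = 0 := by
    intro n
    induction n using Nat.strong_induction_on with
    | _ n ih =>
      rcases Nat.lt_or_ge (L + 2) n with hlt | hge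
      · rcases Nat.lt_or_ge n (2 * (L + 2)) with h | h
        · have e := ih (2 * (L + 2) - n) (by omega)
          have e2 := (hup _).1 (hneg _ e)
          have : -((2 * (L + 2) - n : ℕ) : ℤ) + 2 * (L + 2 : ℕ) = n := by omega
          rwa [this] at e2
        · have e := (hup _).1 (ih (n - 2 * (L + 2)) (by omega))
          have : ((n - 2 * (L + 2) : ℕ) : ℤ) + 2 * (L + 2 : ℕ) = n := by omega
          rwa [this] at e
      · exact hsmall n hge
  refine eq_zero_of_fc h1 h2 fun m => ?_
  obtain ⟨n, rfl | rfl⟩ := m.eq_nat_or_neg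
  · exact hnat n
  · exact hneg _ (hnat n)

theorem fc_lin {f g : ℂ → ℂ} (hf : Continuous f) (hg : Continuous g) (c : ℂ) (m : ℤ) :
    fc (f + g) m = fc f m + fc g m ∧ fc (c • f) m = c * fc f m := by
  have hi : ∀ k : ℂ → ℂ, Continuous k → IntervalIntegrable
      (fun x : ℝ => k x * cexp (-(2 * π * I * m * x))) MeasureTheory.volume 0 1 := fun k hk =>
    Continuous.intervalIntegrable (by fun_prop) 0 1
  constructor
  · unfold fc
    rw [← intervalIntegral.integral_add (hi f hf) (hi g hg)]
    refine intervalIntegral.integral_congr fun x _ => ?_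
    simp [add_mul]
  · unfold fc
    rw [← intervalIntegral.integral_const_mul]
    refine intervalIntegral.integral_congr fun x _ => ?_
    simp [mul_assoc]

/-- The first `L + 1` Fourier coefficients determine an odd theta function. -/
def oddCoeff (τ : ℂ) (L : ℕ) : oddTheta τ (L + 2) →ₗ[ℂ] (Fin (L + 1) → ℂ) where
  toFun f m := fc f.1 (m + 1)
  map_add' f g := by
    ext m; exact (fc_lin f.2.1.continuous g.2.1.continuous 0 _).1
  map_smul' c f := by
    ext m; exact (fc_lin f.2.1.continuous f.2.1.continuous c _).2

theorem oddCoeff_injective (t : ℝ) (L : ℕ) : Function.Injective (oddCoeff (t * I) L) := by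
  rw [← LinearMap.ker_eq_bot, LinearMap.ker_eq_bot']
  intro f hf
  exact Subtype.ext (odd_eq_zero f.2 fun m => congrFun hf m)

/-- The theta functions `F_j + F_{-j}`, an explicit independent family in `evenTheta`. -/
def evenBasis (τ : ℂ) (L : ℕ) (j : ℤ) (z : ℂ) : ℂ :=
  cexp (2 * π * I * j * z) * jacobiTheta₂ (2 * L * z + j * τ) (2 * L * τ) +
  cexp (-(2 * π * I * j * z)) * jacobiTheta₂ (2 * L * z - j * τ) (2 * L * τ)

theorem jacobiTheta₂_add_nat (z τ : ℂ) (n : ℕ) : jacobiTheta₂ (z + n) τ = jacobiTheta₂ z τ := by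
  induction n with
  | zero => simp
  | succ n ih => push_cast; rw [← add_assoc, jacobiTheta₂_add_left, ih]

theorem evenBasis_mem {t : ℝ} (ht : 0 < t) {L : ℕ} (hL : 0 < L) (j : ℤ) :
    evenBasis (t * I) L j ∈ evenTheta (t * I) L := by
  have him : 0 < (2 * L * (t * I) : ℂ).im := by
    have : (2 * L * (t * I) : ℂ) = ((2 * L * t : ℝ) : ℂ) * I := by push_cast; ring
    rw [this]; simp; positivity
  have hth : Differentiable ℂ fun z => jacobiTheta₂ z (2 * L * (t * I)) := fun z =>
    differentiableAt_jacobiTheta₂_fst z him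
  refine ⟨?_, fun z => ?_, fun z => ?_, fun z => ?_⟩
  · have h1 : Differentiable ℂ fun z : ℂ => 2 * L * z + j * (t * I) := by fun_prop
    have h2 : Differentiable ℂ fun z : ℂ => 2 * L * z - j * (t * I) := by fun_prop
    exact Differentiable.add (Differentiable.mul (by fun_prop) (hth.comp h1))
      (Differentiable.mul (by fun_prop) (hth.comp h2))
  · unfold evenBasis
    have e1 : (2 * L * (z + 1) + j * (t * I) : ℂ) = 2 * L * z + j * (t * I) + (2 * L : ℕ) := by
      push_cast; ring
    have e2 : (2 * L * (z + 1) - j * (t * I) : ℂ) = 2 * L * z - j * (t * I) + (2 * L : ℕ) := by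
      push_cast; ring
    rw [e1, e2, jacobiTheta₂_add_nat, jacobiTheta₂_add_nat]
    congr 2
    · rw [Complex.exp_eq_exp_iff_exists_int]; exact ⟨j, by ring⟩
    · rw [Complex.exp_eq_exp_iff_exists_int]; exact ⟨-j, by push_cast; ring⟩
  · unfold evenBasis
    have e1 : (2 * L * (-z) + j * (t * I) : ℂ) = -(2 * L * z - j * (t * I)) := by ring
    have e2 : (2 * L * (-z) - j * (t * I) : ℂ) = -(2 * L * z + j * (t * I)) := by ring
    rw [e1, e2, jacobiTheta₂_neg_left, jacobiTheta₂_neg_left, add_comm]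
    congr 3 <;> ring
  · unfold evenBasis
    have e1 : (2 * L * (z + t * I) + j * (t * I) : ℂ) =
      2 * L * z + j * (t * I) + 2 * L * (t * I) := by ring
    have e2 : (2 * L * (z + t * I) - j * (t * I) : ℂ) =
      2 * L * z - j * (t * I) + 2 * L * (t * I) := by ring
    rw [e1, e2, jacobiTheta₂_add_left', jacobiTheta₂_add_left', mul_add]
    have aux : ∀ A B C D y : ℂ, A + B = C + D → cexp A * (cexp B * y) = cexp C * (cexp D * y) := by
      intro A B C D y e
      have := congrArg cexp e
      rw [Complex.exp_add, Complex.exp_add] at this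
      linear_combination y * this
    refine Eq.trans ?_ (mul_add _ _ _).symm
    congr 1 <;> (apply aux; ring)

theorem evenBasis_zero_ne {t : ℝ} (ht : 0 < t) {L : ℕ} (hL : 0 < L) (j : ℤ) :
    evenBasis (t * I) L j 0 ≠ 0 := by
  have h := jacobiTheta₂_imag_ne_zero (j * t) (t := 2 * L * t) (by positivity)
  unfold evenBasis
  have e2 : (2 * L * 0 - j * (t * I) : ℂ) = -(2 * L * 0 + j * (t * I)) := by ring
  rw [e2, jacobiTheta₂_neg_left]
  push_cast at h
  simp only [mul_zero, neg_zero, Complex.exp_zero, one_mul, zero_add, ← two_mul]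
  refine mul_ne_zero two_ne_zero ?_
  simpa only [mul_assoc] using h

theorem evenBasis_shift {L : ℕ} (hL : 0 < L) (τ : ℂ) (j : ℤ) (z : ℂ) :
    evenBasis τ L j (z + 1 / (2 * L)) + evenBasis τ L j (z - 1 / (2 * L)) =
      (2 * Real.cos (π * j / L) : ℝ) * evenBasis τ L j z := by
  have hL' : (L : ℂ) ≠ 0 := by exact_mod_cast hL.ne'
  unfold evenBasis
  have s1 : ∀ w : ℂ, (2 * L * (z + 1 / (2 * L)) + w : ℂ) = 2 * L * z + w + 1 := fun w => by
    field_simp; ring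
  have s2 : ∀ w : ℂ, jacobiTheta₂ (2 * L * (z - 1 / (2 * L)) + w) (2 * L * τ) =
      jacobiTheta₂ (2 * L * z + w) (2 * L * τ) := fun w => by
    rw [← jacobiTheta₂_add_left]
    congr 1
    field_simp; ring
  have c1 : ((2 * Real.cos (π * j / L) : ℝ) : ℂ) =
      cexp (π * j / L * I) + cexp (-(π * j / L) * I) := by
    push_cast
    rw [Complex.two_cos]
  have x1 : cexp (2 * π * I * j * (z + 1 / (2 * L))) =
      cexp (2 * π * I * j * z) * cexp (π * j / L * I) := by
    rw [← Complex.exp_add]; congr 1; field_simp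
  have x2 : cexp (2 * π * I * j * (z - 1 / (2 * L))) =
      cexp (2 * π * I * j * z) * cexp (-(π * j / L) * I) := by
    rw [← Complex.exp_add]; congr 1; field_simp; ring
  have x3 : cexp (-(2 * π * I * j * (z + 1 / (2 * L)))) =
      cexp (-(2 * π * I * j * z)) * cexp (-(π * j / L) * I) := by
    rw [← Complex.exp_add]; congr 1; field_simp; ring
  have x4 : cexp (-(2 * π * I * j * (z - 1 / (2 * L)))) =
      cexp (-(2 * π * I * j * z)) * cexp (π * j / L * I) := by
    rw [← Complex.exp_add]; congr 1; field_simp; ring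
  simp only [sub_eq_add_neg (2 * L * (_ : ℂ)) (j * τ), s1, s2, jacobiTheta₂_add_left, c1, x1, x2,
    x3, x4]
  ring

theorem evenBasis_independent {t : ℝ} (ht : 0 < t) {L : ℕ} (hL : 0 < L) :
    LinearIndependent ℂ fun j : Fin (L + 1) => evenBasis (t * I) L (j : ℕ) := by
  let U : Module.End ℂ (ℂ → ℂ) :=
    LinearMap.funLeft ℂ ℂ (fun z => z + 1 / (2 * L : ℂ)) +
      LinearMap.funLeft ℂ ℂ (fun z => z - 1 / (2 * L : ℂ))
  refine Module.End.eigenvectors_linearIndependent' U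
    (fun j : Fin (L + 1) => ((2 * Real.cos (π * ((j : ℕ) : ℤ) / L) : ℝ) : ℂ)) ?_ _ fun j => ?_
  · intro i j hij
    have h := Complex.ofReal_injective hij
    have hLr : (0 : ℝ) < L := by exact_mod_cast hL
    have hmem : ∀ k : Fin (L + 1), π * (((k : ℕ) : ℤ) : ℝ) / L ∈ Set.Icc 0 π := fun k => by
      have hk : ((k : ℕ) : ℝ) ≤ L := by exact_mod_cast Nat.lt_succ_iff.1 k.2
      constructor
      · push_cast; positivity
      · push_cast
        rw [div_le_iff₀ hLr]
        exact mul_le_mul_of_nonneg_left hk Real.pi_pos.le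
    have h2 := Real.injOn_cos (hmem i) (hmem j) (by linarith)
    have h3 : (((i : ℕ) : ℤ) : ℝ) = (((j : ℕ) : ℤ) : ℝ) := by
      have := Real.pi_pos.ne'
      field_simp at h2
      exact h2
    exact Fin.ext (by exact_mod_cast h3)
  · rw [Module.End.hasEigenvector_iff, Module.End.mem_eigenspace_iff]
    refine ⟨?_, fun h0 => evenBasis_zero_ne ht hL (j : ℕ) (by rw [h0]; rfl)⟩
    funext z
    exact evenBasis_shift hL _ _ z

theorem theta_one_one_two_ne {t : ℝ} (ht : 0 < t) : ∃ z, theta 1 1 (2 * z) (t * I) ≠ 0 := by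
  refine ⟨-(1 + t * I) / 4, ?_⟩
  rw [theta_eq]
  refine mul_ne_zero (Complex.exp_ne_zero _) ?_
  have h := jacobiTheta₂_imag_ne_zero 0 ht
  convert h using 2
  push_cast; ring

/-- Multiplication by `θ₁₁(2z)`, from `evenTheta` to `oddTheta`. -/
def mulTheta {τ : ℂ} (hτ : 0 < τ.im) (L : ℕ) : evenTheta τ L →ₗ[ℂ] oddTheta τ (L + 2) where
  toFun f := ⟨fun z => theta 1 1 (2 * z) τ * f.1 z, by
    obtain ⟨f, h1, h2, h3, h4⟩ := f
    refine ⟨?_, fun z => ?_, fun z => ?_, fun z => ?_⟩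
    · exact Differentiable.mul ((theta_differentiable 1 1 hτ).comp (by fun_prop)) h1
    · simp only [h2, mul_add, mul_one, theta_add_two]
    · simp only [h3, mul_neg, theta_one_one_neg, neg_mul]
    · simp only [h4, mul_add, theta_add_two_mul]
      have : cexp (-(2 * ((L + 2 : ℕ) : ℂ) * π * I * (2 * z) + 2 * ((L + 2 : ℕ) : ℂ) * π * I * τ))
          = cexp (-(4 * π * I * (2 * z) + 4 * π * I * τ)) *
            cexp (-(2 * L * π * I * (2 * z) + 2 * L * π * I * τ)) := by
        rw [← Complex.exp_add]; congr 1; push_cast; ring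
      rw [this]; ring⟩
  map_add' f g := by ext z; simp [mul_add]
  map_smul' c f := by ext z; simp; ring

theorem mulTheta_bijective {t : ℝ} (ht : 0 < t) {τ : ℂ} (hτ : 0 < τ.im) (hτt : τ = t * I) (L : ℕ) :
    Function.Bijective (mulTheta hτ L) := by
  subst hτt
  have hinj : Function.Injective (mulTheta hτ L) := by
    rw [← LinearMap.ker_eq_bot, LinearMap.ker_eq_bot']
    rintro ⟨f, hf⟩ h0
    have h : ∀ z, theta 1 1 (2 * z) (t * I) * f z = 0 := fun z =>
      congrFun (congrArg Subtype.val h0) z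
    obtain ⟨z₀, hz₀⟩ := theta_one_one_two_ne ht
    have hd : Differentiable ℂ fun z : ℂ => theta 1 1 (2 * z) (t * I) :=
      (theta_differentiable 1 1 hτ).comp (by fun_prop)
    have hev : ∀ᶠ z in nhds z₀, f z = 0 := by
      filter_upwards [hd.continuous.continuousAt.eventually_ne hz₀] with z hz
      exact (mul_eq_zero.1 (h z)).resolve_left hz
    have ha : AnalyticOnNhd ℂ f Set.univ := hf.1.differentiableOn.analyticOnNhd isOpen_univ
    have h00 : AnalyticOnNhd ℂ (0 : ℂ → ℂ) Set.univ := fun _ _ => analyticAt_const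
    exact Subtype.ext (ha.eq_of_eventuallyEq h00 hev)
  refine ⟨hinj, ?_⟩
  have i1 : FiniteDimensional ℂ (oddTheta (t * I) (L + 2)) :=
    Module.Finite.of_injective _ (oddCoeff_injective t L)
  have i2 : FiniteDimensional ℂ (evenTheta (t * I) L) := Module.Finite.of_injective _ hinj
  have h1 : Module.finrank ℂ (oddTheta (t * I) (L + 2)) ≤ L + 1 := by
    have := LinearMap.finrank_le_finrank_of_injective (oddCoeff_injective t L)
    simpa using this
  have h2 : Module.finrank ℂ (evenTheta (t * I) L) ≤ Module.finrank ℂ (oddTheta (t * I) (L + 2)) :=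
    LinearMap.finrank_le_finrank_of_injective hinj
  have h3 : L + 1 ≤ Module.finrank ℂ (evenTheta (t * I) L) := by
    rcases Nat.eq_zero_or_pos L with rfl | hL
    · have hmem : (fun _ => 1 : ℂ → ℂ) ∈ evenTheta (t * I) 0 := by
        refine ⟨differentiable_const 1, fun z => rfl, fun z => rfl, fun z => by simp⟩
      have : Nontrivial (evenTheta (t * I) 0) := ⟨⟨⟨_, hmem⟩, 0, fun h => by
        have := congrFun (congrArg Subtype.val h) 0
        simp at this⟩⟩
      exact Module.finrank_pos
    · have hli : LinearIndependent ℂ fun j : Fin (L + 1) =>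
          (⟨_, evenBasis_mem ht hL (j : ℕ)⟩ : evenTheta (t * I) L) :=
        LinearIndependent.of_comp (Submodule.subtype _) (evenBasis_independent ht hL)
      simpa using hli.fintype_card_le_finrank
  exact (LinearMap.injective_iff_surjective_of_finrank_eq_finrank (by omega)).1 hinj

/-- The numerator `s(z-ℓη) f(z+η) - s(-z-ℓη) f(z-η)` with `s(z) = c θ_{pq}(2z)`, `ℓ = L/2`. -/
def diffNumerator {τ : ℂ} (hτ : 0 < τ.im) (L : ℕ) (η c : ℂ) (p q : ℕ) :
    evenTheta τ L →ₗ[ℂ] oddTheta τ (L + 2) where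
  toFun f := ⟨fun z => c * theta p q (2 * (z - L / 2 * η)) τ * f.1 (z + η) -
      c * theta p q (2 * (-z - L / 2 * η)) τ * f.1 (z - η), by
    obtain ⟨f, h1, h2, h3, h4⟩ := f
    have hθ := theta_differentiable p q hτ
    refine ⟨?_, fun z => ?_, fun z => ?_, fun z => ?_⟩
    · have a1 : Differentiable ℂ fun z : ℂ => theta p q (2 * (z - L / 2 * η)) τ :=
        hθ.comp (by fun_prop)
      have a2 : Differentiable ℂ fun z : ℂ => theta p q (2 * (-z - L / 2 * η)) τ :=
        hθ.comp (by fun_prop)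
      have b1 : Differentiable ℂ fun z : ℂ => f (z + η) := h1.comp (by fun_prop)
      have b2 : Differentiable ℂ fun z : ℂ => f (z - η) := h1.comp (by fun_prop)
      exact ((a1.const_mul c).mul b1).sub ((a2.const_mul c).mul b2)
    · have e1 : (2 * (z + 1 - L / 2 * η) : ℂ) = 2 * (z - L / 2 * η) + 2 := by ring
      have e2 : theta p q (2 * (-(z + 1) - L / 2 * η)) τ = theta p q (2 * (-z - L / 2 * η)) τ := by
        rw [← theta_add_two]; congr 1; ring
      have e3 : z + 1 + η = z + η + 1 := by ring
      have e4 : z + 1 - η = z - η + 1 := by ring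
      simp only [e1, e2, e3, e4, h2, theta_add_two]
    · have e1 : -z + η = -(z - η) := by ring
      have e2 : -z - η = -(z + η) := by ring
      simp only [e1, e2, h3, neg_neg]; ring
    · have e1 : (2 * (z + τ - L / 2 * η) : ℂ) = 2 * (z - L / 2 * η) + 2 * τ := by ring
      have e2 : theta p q (2 * (-z - L / 2 * η)) τ =
          cexp (-(4 * π * I * (2 * (-(z + τ) - L / 2 * η) + τ))) *
            theta p q (2 * (-(z + τ) - L / 2 * η)) τ := by
        rw [← theta_add_two_mul]; congr 1; ring
      have e3 : z + τ + η = z + η + τ := by ring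
      have e4 : z + τ - η = z - η + τ := by ring
      simp only [e1, e3, e4, h4, theta_add_two_mul, e2]
      have x1 : cexp (-(4 * π * I * (2 * (z - L / 2 * η) + τ))) *
          cexp (-(2 * L * π * I * (2 * (z + η) + τ))) =
          cexp (-(2 * ((L + 2 : ℕ) : ℂ) * π * I * (2 * z + τ))) := by
        rw [← Complex.exp_add]; congr 1; push_cast; ring
      have x2 : cexp (-(2 * L * π * I * (2 * (z - η) + τ))) =
          cexp (-(2 * ((L + 2 : ℕ) : ℂ) * π * I * (2 * z + τ))) *
          cexp (-(4 * π * I * (2 * (-(z + τ) - L / 2 * η) + τ))) := by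
        rw [← Complex.exp_add]; congr 1; push_cast; ring
      rw [x2, ← x1]; ring⟩
  map_add' f g := by ext z; simp; ring
  map_smul' c f := by ext z; simp; ring

/-- Data of the model: `τ = i/t` with `t > 0`, `η = r'/r` with `r` even, `r'` odd, `r` and `r'`
coprime, and the spin `ℓ = L/2`. The condition `2 < r` says `2η ∉ ℤ`. -/
structure Model where
  t : ℝ
  t_pos : 0 < t
  r : ℕ
  r' : ℤ
  r_even : Even r
  r'_odd : Odd r'
  coprime : IsCoprime (r : ℤ) r'
  two_lt_r : 2 < r
  L : ℕ

namespace Model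

variable (P : Model)

def τ : ℂ := I / P.t

def η : ℂ := (P.r' : ℂ) / P.r

/-- The spin `ℓ`, as a complex number. -/
def ℓ : ℂ := (P.L : ℂ) / 2

/-- `θ_{ab}(z) = θ_{ab}(z; τ)`. -/
def th (a b : ℕ) (z : ℂ) : ℂ := theta a b z P.τ

theorem τ_eq : P.τ = ((P.t⁻¹ : ℝ) : ℂ) * I := by
  unfold τ; push_cast; rw [div_eq_mul_inv, mul_comm]

theorem τ_im : 0 < P.τ.im := by
  rw [τ_eq]; simpa using P.t_pos

/-- The spin `ℓ` representation space `Θ^{4ℓ+}_{00}`. -/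
abbrev V : Type := evenTheta P.τ P.L

/-- Multiplication by `θ₁₁(2z)` is a linear bijection from even to odd theta functions. -/
def mulEquiv : P.V ≃ₗ[ℂ] oddTheta P.τ (P.L + 2) :=
  LinearEquiv.ofBijective (mulTheta P.τ_im P.L)
    (mulTheta_bijective (inv_pos.2 P.t_pos) P.τ_im P.τ_eq P.L)

/-- `θ_{ab}` attached to the index `0, 1, 2, 3`: `θ₁₁, θ₁₀, θ₀₀, θ₀₁`. -/
def thIdx : Fin 4 → ℂ → ℂ := ![P.th 1 1, P.th 1 0, P.th 0 0, P.th 0 1]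

/-- `s_a(z)` of the spin `ℓ` representation. -/
def sFun (a : Fin 4) (z : ℂ) : ℂ := ![1, 1, I, 1] a * P.thIdx a P.η * P.thIdx a (2 * z)

/-- The operator `ρ^ℓ(S^a)`:
`f ↦ (s_a(z-ℓη) f(z+η) - s_a(-z-ℓη) f(z-η)) / θ₁₁(2z)`; the division is carried out by inverting
multiplication by `θ₁₁(2z)`. See `rho_spec` for the formula. -/
def rho (a : Fin 4) : Module.End ℂ P.V :=
  P.mulEquiv.symm.toLinearMap ∘ₗ
    diffNumerator P.τ_im P.L P.η (![1, 1, I, 1] a * P.thIdx a P.η) (![1, 1, 0, 0] a) (![1, 0, 0, 1] a)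

theorem rho_spec (a : Fin 4) (f : P.V) (z : ℂ) :
    P.th 1 1 (2 * z) * (P.rho a f).1 z =
      P.sFun a (z - P.ℓ * P.η) * f.1 (z + P.η) - P.sFun a (-z - P.ℓ * P.η) * f.1 (z - P.η) := by
  have h := congrFun (congrArg Subtype.val (P.mulEquiv.apply_symm_apply
    (diffNumerator P.τ_im P.L P.η (![1, 1, I, 1] a * P.thIdx a P.η)
      (![1, 1, 0, 0] a) (![1, 0, 0, 1] a) f))) z
  refine h.trans ?_
  fin_cases a <;> rfl

theorem rho_apply (a : Fin 4) (f : P.V) {z : ℂ} (hz : P.th 1 1 (2 * z) ≠ 0) :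
    (P.rho a f).1 z =
      (P.sFun a (z - P.ℓ * P.η) * f.1 (z + P.η) - P.sFun a (-z - P.ℓ * P.η) * f.1 (z - P.η)) /
        P.th 1 1 (2 * z) := by
  rw [eq_div_iff hz, mul_comm]; exact P.rho_spec a f z

/-- The coefficients `W_a^L(λ)` of the `L` operator. -/
def WL (a : Fin 4) (lam : ℂ) : ℂ := P.thIdx a lam / P.thIdx a P.η

/-- The Pauli matrices. -/
def pauli : Fin 4 → Matrix (Fin 2) (Fin 2) ℂ :=
  ![!![1, 0; 0, 1], !![0, 1; 1, 0], !![0, -I; I, 0], !![1, 0; 0, -1]]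

/-- The Hilbert space `V_N ⊗ ... ⊗ V_1`; the factor with index `n : Fin N` is `V_{n+1}`. -/
abbrev H (N : ℕ) : Type := ⨂[ℂ] _ : Fin N, P.V

variable {N : ℕ}

/-- An operator on `V` acting on the `n`-th tensor factor. -/
def site (n : Fin N) (T : Module.End ℂ P.V) : Module.End ℂ (P.H N) :=
  PiTensorProduct.map (Function.update (fun _ => LinearMap.id) n T)

/-- The `L` operator `L_n(λ) = Σ_a W_a^L(λ) ρ_n(S^a) ⊗ σ^a` as a `2 × 2` matrix of operators. -/
def Lop (n : Fin N) (lam : ℂ) : Matrix (Fin 2) (Fin 2) (Module.End ℂ (P.H N)) :=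
  fun i j => ∑ a : Fin 4, (P.WL a lam * pauli a i j) • P.site n (P.rho a)

/-- The monodromy matrix `L_N(λ) ⋯ L_2(λ) L_1(λ)`. -/
def monodromy (N : ℕ) (lam : ℂ) : Matrix (Fin 2) (Fin 2) (Module.End ℂ (P.H N)) :=
  (List.ofFn fun n : Fin N => P.Lop n lam).reverse.prod

variable (sp sm : ℂ)

/-- `w_k = (s₊ + s₋)/2 + 2kη - τ/2`; the index may be a half integer. -/
def w (k : ℂ) : ℂ := (sp + sm) / 2 + 2 * k * P.η - P.τ / 2

/-- The matrix of gauge transformation `M_k(λ; s)`. -/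
def gauge (k : ℤ) (lam : ℂ) : Matrix (Fin 2) (Fin 2) ℂ :=
  !![theta 1 1 (-I * P.t * (sp - lam + 2 * k * P.η)) (2 * I * P.t),
     theta 1 1 (-I * P.t * (sm + lam + 2 * k * P.η)) (2 * I * P.t);
     theta 0 1 (-I * P.t * (sp - lam + 2 * k * P.η)) (2 * I * P.t),
     theta 0 1 (-I * P.t * (sm + lam + 2 * k * P.η)) (2 * I * P.t)] *
  !![cexp (-(π * P.t / 2) * (sp - lam + 2 * k * P.η - I / (2 * P.t)) ^ 2), 0;
     0, cexp (-(π * P.t / 2) * (sm + lam + 2 * k * P.η - I / (2 * P.t)) ^ 2)] *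
  !![1, 0; 0, (P.th 1 1 (P.w sp sm k))⁻¹]

/-- A complex matrix as a matrix of scalar operators. -/
def scalarMat (N : ℕ) (A : Matrix (Fin 2) (Fin 2) ℂ) :
    Matrix (Fin 2) (Fin 2) (Module.End ℂ (P.H N)) :=
  A.map (algebraMap ℂ (Module.End ℂ (P.H N)))

/-- The twisted monodromy matrix `M_k(λ; s)⁻¹ 𝒯(λ) M_{k'}(λ; s)`. -/
def twistedMonodromy (N : ℕ) (k k' : ℤ) (lam : ℂ) :
    Matrix (Fin 2) (Fin 2) (Module.End ℂ (P.H N)) :=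
  P.scalarMat N (P.gauge sp sm k lam)⁻¹ * P.monodromy N lam * P.scalarMat N (P.gauge sp sm k' lam)

/-- `B_{k,k'}(λ)`, the upper right entry of the twisted monodromy matrix. -/
def B (N : ℕ) (k k' : ℤ) (lam : ℂ) : Module.End ℂ (P.H N) :=
  P.twistedMonodromy sp sm N k k' lam 0 1

/-- `d ∈ {-2ℓ, -2ℓ+2, ..., 2ℓ-2, 2ℓ}`. -/
def Admissible (d : ℤ) : Prop := ∃ n : ℕ, n ≤ P.L ∧ d = 2 * n - P.L

/-- The function underlying the intertwining vector `φ_{k,k'}(λ; s)`; the two products have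
`ℓ + (k-k')/2` and `ℓ - (k-k')/2` factors, and the index `j` here is shifted by one. -/
def phiFun (k k' : ℤ) (lam z : ℂ) : ℂ :=
  cexp (2 * π * I * P.ℓ * (k + k') * P.η) *
    (-cexp (π * I * (sp - sm))) ^ (((k : ℂ) - k') / 2) *
  (∏ j ∈ Finset.range ((P.L + (k - k')) / 2).toNat,
    (P.th 0 0 (z + ((sp - lam) / 2 + P.τ / 4 + (k' - P.ℓ + 2 * (j + 1) - 1) * P.η)) *
     P.th 0 0 (z - ((sp - lam) / 2 + P.τ / 4 + (k' - P.ℓ + 2 * (j + 1) - 1) * P.η)))) *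
  ∏ j ∈ Finset.range ((P.L - (k - k')) / 2).toNat,
    (P.th 0 0 (z + ((sm + lam) / 2 + P.τ / 4 + (k - P.ℓ + 2 * (j + 1) - 1) * P.η)) *
     P.th 0 0 (z - ((sm + lam) / 2 + P.τ / 4 + (k - P.ℓ + 2 * (j + 1) - 1) * P.η)))

theorem prod_mem (n : ℕ) (u : ℕ → ℂ) :
    (fun z => ∏ j ∈ Finset.range n, (P.th 0 0 (z + u j) * P.th 0 0 (z - u j))) ∈
      evenTheta P.τ n := by
  have hθ : Differentiable ℂ (P.th 0 0) := theta_differentiable 0 0 P.τ_im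
  refine ⟨?_, fun z => ?_, fun z => ?_, fun z => ?_⟩
  · refine Differentiable.fun_finsetProd fun j _ => ?_
    exact (hθ.comp (by fun_prop : Differentiable ℂ fun z : ℂ => z + u j)).mul
      (hθ.comp (by fun_prop : Differentiable ℂ fun z : ℂ => z - u j))
  · refine Finset.prod_congr rfl fun j _ => ?_
    unfold th
    rw [show z + 1 + u j = z + u j + 1 by ring, show z + 1 - u j = z - u j + 1 by ring,
      theta_zero_zero_add_one, theta_zero_zero_add_one]
  · refine Finset.prod_congr rfl fun j _ => ?_
    unfold th
    rw [show -z + u j = -(z - u j) by ring, show -z - u j = -(z + u j) by ring,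
      theta_zero_zero_neg, theta_zero_zero_neg, mul_comm]
  · have hj : ∀ j ∈ Finset.range n, P.th 0 0 (z + P.τ + u j) * P.th 0 0 (z + P.τ - u j) =
        cexp (-(2 * π * I * (2 * z + P.τ))) * (P.th 0 0 (z + u j) * P.th 0 0 (z - u j)) := by
      intro j _
      unfold th
      rw [show z + P.τ + u j = z + u j + P.τ by ring, show z + P.τ - u j = z - u j + P.τ by ring,
        theta_zero_zero_add, theta_zero_zero_add]
      have : cexp (-(2 * π * I * (2 * z + P.τ))) = cexp (-(π * I * (2 * (z + u j) + P.τ))) *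
          cexp (-(π * I * (2 * (z - u j) + P.τ))) := by
        rw [← Complex.exp_add]; congr 1; ring
      rw [this]; ring
    change ∏ j ∈ Finset.range n, _ = _ * ∏ j ∈ Finset.range n, _
    rw [Finset.prod_congr rfl hj, Finset.prod_mul_distrib, Finset.prod_const, Finset.card_range,
      ← Complex.exp_nat_mul]
    congr 2; ring

theorem phiFun_mem {k k' : ℤ} (h : P.Admissible (k - k')) (lam : ℂ) :
    P.phiFun sp sm k k' lam ∈ evenTheta P.τ P.L := by
  obtain ⟨n, hn, hd⟩ := h
  have e1 : ((P.L + (k - k')) / 2).toNat = n := by omega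
  have e2 : ((P.L - (k - k')) / 2).toNat = P.L - n := by omega
  have h1 := P.prod_mem n fun j => (sp - lam) / 2 + P.τ / 4 + (k' - P.ℓ + 2 * (j + 1) - 1) * P.η
  have h2 := P.prod_mem (P.L - n) fun j =>
    (sm + lam) / 2 + P.τ / 4 + (k - P.ℓ + 2 * (j + 1) - 1) * P.η
  have key : ∀ (c : ℂ) (f g : ℂ → ℂ), f ∈ evenTheta P.τ n → g ∈ evenTheta P.τ (P.L - n) →
      (fun z => c * f z * g z) ∈ evenTheta P.τ P.L := by
    rintro c f g ⟨f1, f2, f3, f4⟩ ⟨g1, g2, g3, g4⟩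
    refine ⟨(f1.const_mul c).mul g1, fun z => ?_, fun z => ?_, fun z => ?_⟩
    · simp [f2, g2]
    · simp [f3, g3]
    · simp only [f4, g4]
      have : cexp (-(2 * P.L * π * I * (2 * z + P.τ))) =
          cexp (-(2 * n * π * I * (2 * z + P.τ))) *
            cexp (-(2 * ((P.L - n : ℕ) : ℂ) * π * I * (2 * z + P.τ))) := by
        rw [← Complex.exp_add]; congr 1; push_cast [hn]; ring
      rw [this]; ring
  have := key (cexp (2 * π * I * P.ℓ * (k + k') * P.η) *
    (-cexp (π * I * (sp - sm))) ^ (((k : ℂ) - k') / 2)) _ _ h1 h2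
  unfold phiFun
  rw [e1, e2]
  exact this

open Classical in
/-- The intertwining vector `φ_{k,k'}(λ; s)`, for `k - k' ∈ {-2ℓ, -2ℓ+2, ..., 2ℓ}`; it is only
used for such `k, k'` and set to `0` otherwise. -/
def phi (k k' : ℤ) (lam : ℂ) : P.V :=
  if h : P.Admissible (k - k') then ⟨P.phiFun sp sm k k' lam, P.phiFun_mem sp sm h lam⟩ else 0

/-- The fundamental vector
`|a_N, ..., a_1, a_0⟩ = φ_{a_N, a_{N-1}}(0; s) ⊗ ⋯ ⊗ φ_{a_1, a_0}(0; s)`. -/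
def fundamental (b : Fin (N + 1) → ℤ) : P.H N :=
  PiTensorProduct.tprod ℂ fun n : Fin N => P.phi sp sm (b n.succ) (b n.castSucc) 0

/-- The pseudo vacuum `Ω^a_N = |a + 2Nℓ, ..., a + 2ℓ, a⟩`. -/
def vacuum (N : ℕ) (a : ℤ) : P.H N :=
  P.fundamental sp sm fun j : Fin (N + 1) => a + P.L * (j : ℕ)

variable {M : ℕ}

/-- `Φ_a(λ_1, ..., λ_M) = B_{a+1,a-1}(λ_1) ⋯ B_{a+M,a-M}(λ_M) Ω^{a-M}_N`. -/
def PhiVec (N : ℕ) (a : ℤ) (lam : Fin M → ℂ) : P.H N :=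
  (List.ofFn fun i : Fin M =>
    P.B sp sm N (a + ((i : ℕ) + 1)) (a - ((i : ℕ) + 1)) (lam i)).prod (P.vacuum sp sm N (a - M))

/-- The Bethe vector `Ψ_ν(λ_1, ..., λ_M)`. -/
def bethe (N : ℕ) (ν : ℤ) (lam : Fin M → ℂ) : P.H N :=
  ∑ a ∈ Finset.range P.r, cexp (2 * π * I * ν * P.η * a) • P.PhiVec sp sm N a lam

/-- The Boltzmann weight of SOS type `W[k k'; m m' | λ]`, where `m = k ± 1`, `m' = k' ± 1`. -/
def W (k k' m m' : ℤ) (lam : ℂ) : ℂ :=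
  if m = k - 1 ∧ m' = k' - 1 then
    2 * P.th 1 1 (lam + (k - k') * P.η) *
      (P.th 1 1 (P.w sp sm ((k + k' + 2 * P.ℓ) / 2)) / P.th 1 1 (P.w sp sm k))
  else if m = k - 1 ∧ m' = k' + 1 then
    2 * P.th 1 1 ((k' - k - 2 * P.ℓ) * P.η) *
      (P.th 1 1 (P.w sp sm ((k + k') / 2) + lam) /
        (P.th 1 1 (P.w sp sm k) * P.th 1 1 (P.w sp sm k')))
  else if m = k + 1 ∧ m' = k' - 1 then
    2 * P.th 1 1 ((k - k' - 2 * P.ℓ) * P.η) * P.th 1 1 (P.w sp sm ((k + k') / 2) - lam)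
  else if m = k + 1 ∧ m' = k' + 1 then
    2 * P.th 1 1 (lam - (k - k') * P.η) *
      (P.th 1 1 (P.w sp sm ((k + k' - 2 * P.ℓ) / 2)) / P.th 1 1 (P.w sp sm k'))
  else 0

/-- Sequences `a_0 = a, a_1, ..., a_{N-1}, a_N = a` indexing fundamental vectors. -/
def pathSet (N : ℕ) (a : ℤ) : Set (Fin (N + 1) → ℤ) :=
  {b | b 0 = a ∧ b (Fin.last N) = a ∧ ∀ j : Fin N, P.Admissible (b j.succ - b j.castSucc)}

/-- Height configurations `a_{i,j}`, `0 ≤ i ≤ M`, `0 ≤ j ≤ N`, satisfying the admissibility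
condition and the boundary condition. -/
def configSet (N M : ℕ) (a : ℤ) (b : Fin (N + 1) → ℤ) : Set (Fin (M + 1) → Fin (N + 1) → ℤ) :=
  {c | (∀ (i : Fin M) (j : Fin (N + 1)),
          c i.succ j - c i.castSucc j = 1 ∨ c i.succ j - c i.castSucc j = -1) ∧
       (∀ (i : Fin (M + 1)) (j : Fin N), P.Admissible (c i j.succ - c i j.castSucc)) ∧
       (∀ j, c 0 j = b j) ∧
       (∀ j : Fin (N + 1), c (Fin.last M) j = a - M + P.L * (j : ℕ)) ∧
       (∀ i : Fin (M + 1), c i 0 = a - (i : ℕ)) ∧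
       (∀ i : Fin (M + 1), c i (Fin.last N) = a + (i : ℕ))}

theorem abs_sub_le_of_admissible {b : Fin (N + 1) → ℤ}
    (h : ∀ j : Fin N, P.Admissible (b j.succ - b j.castSucc)) (j : Fin (N + 1)) :
    b 0 - P.L * N ≤ b j ∧ b j ≤ b 0 + P.L * N := by
  have key : ∀ n : ℕ, ∀ hn : n < N + 1,
      b 0 - P.L * n ≤ b ⟨n, hn⟩ ∧ b ⟨n, hn⟩ ≤ b 0 + P.L * n := by
    intro n
    induction n with
    | zero => intro hn; simp
    | succ n ih =>
      intro hn
      have h1 := ih (by omega)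
      obtain ⟨m, hm, hd⟩ := h ⟨n, by omega⟩
      have e1 : (Fin.succ (⟨n, by omega⟩ : Fin N)) = ⟨n + 1, hn⟩ := rfl
      have e2 : (Fin.castSucc (⟨n, by omega⟩ : Fin N)) = ⟨n, by omega⟩ := rfl
      rw [e1, e2] at hd
      have hm' : (m : ℤ) ≤ P.L := by exact_mod_cast hm
      push_cast
      rw [mul_add, mul_one]
      constructor <;> omega
  have h1 := key j j.2
  have hj : ((j : ℕ) : ℤ) ≤ N := by exact_mod_cast Nat.lt_succ_iff.1 j.2
  have h2 : (P.L : ℤ) * ((j : ℕ) : ℤ) ≤ P.L * N := mul_le_mul_of_nonneg_left hj (by positivity)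
  constructor
  · linarith [h1.1]
  · linarith [h1.2]

theorem pathSet_finite (N : ℕ) (a : ℤ) : (P.pathSet N a).Finite := by
  refine (Set.Finite.pi' fun _ => Set.finite_Icc (a - P.L * N) (a + P.L * N)).subset ?_
  rintro b ⟨h0, -, h⟩ j
  have := P.abs_sub_le_of_admissible h j
  rw [h0] at this
  exact this

theorem configSet_finite (N M : ℕ) (a : ℤ) (b : Fin (N + 1) → ℤ) :
    (P.configSet N M a b).Finite := by
  refine (Set.Finite.pi' fun i : Fin (M + 1) => Set.Finite.pi' fun _ : Fin (N + 1) =>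
    Set.finite_Icc (a - (i : ℕ) - P.L * N) (a - (i : ℕ) + P.L * N)).subset ?_
  rintro c ⟨-, h, -, -, h0, -⟩ i j
  have := P.abs_sub_le_of_admissible (h i) j
  rw [h0] at this
  exact this

/-- The finite set of sequences in `pathSet`. -/
def paths (N : ℕ) (a : ℤ) : Finset (Fin (N + 1) → ℤ) := (P.pathSet_finite N a).toFinset

/-- The finite set of configurations in `configSet`. -/
def configs (N M : ℕ) (a : ℤ) (b : Fin (N + 1) → ℤ) : Finset (Fin (M + 1) → Fin (N + 1) → ℤ) :=
  (P.configSet_finite N M a b).toFinset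

end Model

end
end EightVertex

/-!
The Bethe vector is a product of operators `B` applied to the pseudo vacuum, which is itself a
fundamental vector. The theorem follows by iterating the action of a single `B` on a fundamental
vector, given by `B_fundamental`: the result is a sum over a new row of heights, weighted by face
weights. The sum over rows is collected in `prod_B_fundamental`.

The action of `B` reduces to one tensor factor by the vertex-face correspondence `locL_gauge`: for a
single site, `L(λ) M_{k'}(λ)` applied to the intertwining vector `φ_{k,k'}` equals `M_k(λ)` times the
matrix of face weights and neighbouring intertwining vectors. In the product of the `L` operators the
gauge transformations between neighbouring sites cancel (`pathSum_gauge`), whatever heights are used,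
so one can take the heights of the fundamental vector on which the operator acts.

For the correspondence itself, all functions are expressed through the vectors
`halfVec p = (θ₀₁(p; τ/2), θ₀₀(p; τ/2))`. By Jacobi's imaginary transformation, the columns of the
gauge transformation are multiples of such vectors (`gauge_column`). By the addition formulas, the
coefficient matrix of the `L` operator has rank one, with such vectors as factors
(`sum_thIdx_mul_pauli`); here one needs `θ_{ab}(η) ≠ 0`, which is `thIdx_η_ne_zero`. Scalar products
and determinants of these vectors are products of two theta functions of period `τ` (`halfVec_dot`,
`halfVec_det`). Taking determinants with the two columns of `M_k(λ)` therefore turns the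
correspondence into scalar identities: after removal of the common factors of the intertwining
vectors, each is the four-term relation `theta_prod_sub_theta_prod`, which is Lagrange's identity for
scalar products of vectors in `ℂ²`.
-/

namespace EightVertex

/-! ### Addition formulas for theta functions -/

/-- The summand of `theta`. -/
noncomputable def thetaTerm (a b : ℕ) (z τ : ℂ) (n : ℤ) : ℂ :=
  cexp (π * I * ((a : ℂ) / 2 + n) ^ 2 * τ + 2 * π * I * ((a : ℂ) / 2 + n) * ((b : ℂ) / 2 + z))

theorem hasSum_theta (a b : ℕ) (z : ℂ) {τ : ℂ} (hτ : 0 < τ.im) :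
    HasSum (thetaTerm a b z τ) (theta a b z τ) := by
  rw [theta_eq]
  refine ((hasSum_jacobiTheta₂_term (z + (b : ℂ) / 2 + (a : ℂ) / 2 * τ) hτ).mul_left
    (cexp (π * I * (a : ℂ) ^ 2 / 4 * τ + π * I * a * ((b : ℂ) / 2 + z)))).congr_fun ?_
  intro n
  rw [jacobiTheta₂_term, thetaTerm, ← Complex.exp_add]
  congr 1; ring

theorem hasSum_theta_mul_theta (a b c d : ℕ) (x y : ℂ) {τ : ℂ} (hτ : 0 < τ.im) :
    HasSum (fun n : ℤ × ℤ => thetaTerm a b x τ n.1 * thetaTerm c d y τ n.2)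
      (theta a b x τ * theta c d y τ) :=
  have h1 := hasSum_theta a b x hτ
  have h2 := hasSum_theta c d y hτ
  h1.mul h2 (summable_mul_of_summable_norm h1.summable.norm h2.summable.norm)

theorem theta_zero_zero_add_half (z τ : ℂ) : theta 0 0 (z + 1 / 2) τ = theta 0 1 z τ := by
  unfold theta
  refine tsum_congr fun n => congrArg cexp ?_
  push_cast; ring

theorem theta_one_zero_add_half (z τ : ℂ) : theta 1 0 (z + 1 / 2) τ = theta 1 1 z τ := by
  unfold theta
  refine tsum_congr fun n => congrArg cexp ?_
  push_cast; ring

theorem theta_one_zero_add_one (z τ : ℂ) : theta 1 0 (z + 1) τ = -theta 1 0 z τ := by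
  unfold theta
  rw [← tsum_neg]
  refine tsum_congr fun n => ?_
  have : ∀ w : ℂ, -cexp w = cexp (w + π * I) := fun w => by
    rw [Complex.exp_add, Complex.exp_pi_mul_I]; ring
  rw [this, Complex.exp_eq_exp_iff_exists_int]
  refine ⟨n, ?_⟩
  push_cast; ring

theorem theta_zero_one_neg (z τ : ℂ) : theta 0 1 (-z) τ = theta 0 1 z τ := by
  rw [← theta_zero_zero_add_half, ← theta_zero_zero_add_half,
    ← theta_zero_zero_neg, ← theta_zero_zero_add_one]
  congr 1; ring

theorem theta_one_one_add (z τ : ℂ) :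
    theta 1 1 (z + τ) τ = -cexp (-(π * I * (2 * z + τ))) * theta 1 1 z τ := by
  have h := jacobiTheta₂_add_left' (z + 1 / 2 + 1 / 2 * τ) τ
  have e : z + τ + 1 / 2 + 1 / 2 * τ = z + 1 / 2 + 1 / 2 * τ + τ := by ring
  simp only [theta_eq, Nat.cast_one]
  have : ∀ w : ℂ, -cexp w = cexp (w + π * I) := fun w => by
    rw [Complex.exp_add, Complex.exp_pi_mul_I]; ring
  rw [e, h, this, ← mul_assoc, ← mul_assoc, ← Complex.exp_add, ← Complex.exp_add]
  congr 1
  rw [Complex.exp_eq_exp_iff_exists_int]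
  exact ⟨-1, by push_cast; ring⟩

/-- The index lattice `ℤ²` is the union of the images of `(a, b) ↦ (a + b, a - b)` and
`(a, b) ↦ (a + b + 1, a - b)`, according to the parity of the sum of the coordinates. -/
def sumDiffEquiv : (ℤ × ℤ) ⊕ (ℤ × ℤ) ≃ ℤ × ℤ where
  toFun := Sum.elim (fun x => (x.1 + x.2, x.1 - x.2)) fun x => (x.1 + x.2 + 1, x.1 - x.2)
  invFun y := if (y.1 + y.2) % 2 = 0 then Sum.inl ((y.1 + y.2) / 2, (y.1 - y.2) / 2)
    else Sum.inr ((y.1 + y.2 - 1) / 2, (y.1 - y.2 - 1) / 2)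
  left_inv := by
    rintro (⟨a, b⟩ | ⟨a, b⟩)
    · have h : (a + b + (a - b)) % 2 = 0 := by omega
      simp only [Sum.elim_inl, h, if_true]
      congr 2 <;> omega
    · have h : ¬ (a + b + 1 + (a - b)) % 2 = 0 := by omega
      simp only [Sum.elim_inr, h, if_false]
      congr 2 <;> omega
  right_inv := by
    rintro ⟨a, b⟩
    by_cases h : (a + b) % 2 = 0
    · simp only [h, if_true, Sum.elim_inl]
      ext <;> simp only <;> omega
    · simp only [h, if_false, Sum.elim_inr]
      ext <;> simp only <;> omega

/-- The product of two theta functions of half period `σ` as a sum of products of period `2σ`. -/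
theorem theta_zero_zero_mul_theta_zero_zero (p v : ℂ) {σ : ℂ} (hσ : 0 < σ.im) :
    theta 0 0 p σ * theta 0 0 v σ =
      theta 0 0 (p + v) (2 * σ) * theta 0 0 (p - v) (2 * σ) +
        theta 1 0 (p + v) (2 * σ) * theta 1 0 (p - v) (2 * σ) := by
  have hσ2 : 0 < (2 * σ).im := by simpa using hσ
  have hL := hasSum_theta_mul_theta 0 0 0 0 p v hσ
  have h1 := hasSum_theta_mul_theta 0 0 0 0 (p + v) (p - v) hσ2
  have h2 := hasSum_theta_mul_theta 1 0 1 0 (p + v) (p - v) hσ2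
  refine (sumDiffEquiv.hasSum_iff.2 hL).unique (HasSum.sum (h1.congr_fun ?_) (h2.congr_fun ?_))
  · rintro ⟨a, b⟩
    simp only [Function.comp, sumDiffEquiv, Equiv.coe_fn_mk, Sum.elim_inl, thetaTerm,
      ← Complex.exp_add]
    congr 1; push_cast; ring
  · rintro ⟨a, b⟩
    simp only [Function.comp, sumDiffEquiv, Equiv.coe_fn_mk, Sum.elim_inr, thetaTerm,
      ← Complex.exp_add]
    congr 1; push_cast; ring

theorem theta_zero_one_mul_theta_zero_one (p v : ℂ) {σ : ℂ} (hσ : 0 < σ.im) :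
    theta 0 1 p σ * theta 0 1 v σ =
      theta 0 0 (p + v) (2 * σ) * theta 0 0 (p - v) (2 * σ) -
        theta 1 0 (p + v) (2 * σ) * theta 1 0 (p - v) (2 * σ) := by
  rw [← theta_zero_zero_add_half, ← theta_zero_zero_add_half,
    theta_zero_zero_mul_theta_zero_zero _ _ hσ,
    show p + 1 / 2 + (v + 1 / 2) = p + v + 1 by ring,
    show p + 1 / 2 - (v + 1 / 2) = p - v by ring, theta_zero_zero_add_one, theta_one_zero_add_one]
  ring

theorem theta_zero_one_mul_theta_zero_zero (p v : ℂ) {σ : ℂ} (hσ : 0 < σ.im) :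
    theta 0 1 p σ * theta 0 0 v σ =
      theta 0 1 (p + v) (2 * σ) * theta 0 1 (p - v) (2 * σ) +
        theta 1 1 (p + v) (2 * σ) * theta 1 1 (p - v) (2 * σ) := by
  rw [← theta_zero_zero_add_half, theta_zero_zero_mul_theta_zero_zero _ _ hσ,
    show p + 1 / 2 + v = p + v + 1 / 2 by ring,
    show p + 1 / 2 - v = p - v + 1 / 2 by ring]
  simp only [theta_zero_zero_add_half, theta_one_zero_add_half]

theorem theta_zero_zero_mul_theta_zero_one (p v : ℂ) {σ : ℂ} (hσ : 0 < σ.im) :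
    theta 0 0 p σ * theta 0 1 v σ =
      theta 0 1 (p + v) (2 * σ) * theta 0 1 (p - v) (2 * σ) -
        theta 1 1 (p + v) (2 * σ) * theta 1 1 (p - v) (2 * σ) := by
  rw [mul_comm, theta_zero_one_mul_theta_zero_zero _ _ hσ, add_comm v p,
    show v - p = -(p - v) by ring, theta_zero_one_neg, theta_one_one_neg]
  ring

/-- The vector `(θ₀₁(p; τ/2), θ₀₀(p; τ/2))`. Up to scalars, the columns of the gauge
transformation and both factors of the (rank one) matrices in the `L` operator have this form. -/
noncomputable def halfVec (τ p : ℂ) : Fin 2 → ℂ := ![theta 0 1 p (τ / 2), theta 0 0 p (τ / 2)]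

theorem im_div_two_pos {τ : ℂ} (hτ : 0 < τ.im) : 0 < (τ / 2).im := by
  simpa using hτ

theorem halfVec_dot (p v : ℂ) {τ : ℂ} (hτ : 0 < τ.im) :
    halfVec τ p 0 * halfVec τ v 0 + halfVec τ p 1 * halfVec τ v 1 =
      2 * (theta 0 0 (p + v) τ * theta 0 0 (p - v) τ) := by
  simp only [halfVec, Matrix.cons_val_zero, Matrix.cons_val_one]
  rw [theta_zero_one_mul_theta_zero_one _ _ (im_div_two_pos hτ),
    theta_zero_zero_mul_theta_zero_zero _ _ (im_div_two_pos hτ), mul_div_cancel₀ _ two_ne_zero]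
  ring

theorem halfVec_det (p v : ℂ) {τ : ℂ} (hτ : 0 < τ.im) :
    halfVec τ p 0 * halfVec τ v 1 - halfVec τ p 1 * halfVec τ v 0 =
      2 * (theta 1 1 (p + v) τ * theta 1 1 (p - v) τ) := by
  simp only [halfVec, Matrix.cons_val_zero, Matrix.cons_val_one]
  rw [theta_zero_one_mul_theta_zero_zero _ _ (im_div_two_pos hτ),
    theta_zero_zero_mul_theta_zero_one _ _ (im_div_two_pos hτ), mul_div_cancel₀ _ two_ne_zero]
  ring

/-- A four-term addition formula of Riemann type. Both products on the left are products of two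
scalar products of the vectors `halfVec`, so their difference is, by Lagrange's identity, a product
of two determinants. -/
theorem theta_prod_sub_theta_prod {τ : ℂ} (hτ : 0 < τ.im) (z a b c d : ℂ)
    (h : a + b + c + d = 0) :
    theta 0 0 (z + a) τ * theta 0 0 (z + b) τ * theta 0 0 (z + c) τ * theta 0 0 (z + d) τ -
      theta 0 0 (z - a) τ * theta 0 0 (z - b) τ * theta 0 0 (z - c) τ * theta 0 0 (z - d) τ =
      theta 1 1 (2 * z) τ * theta 1 1 (a + b) τ * theta 1 1 (a + c) τ * theta 1 1 (a + d) τ := by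
  obtain rfl : d = -(a + b + c) := by linear_combination h
  have h1 := halfVec_dot (z + (a + b) / 2) ((a - b) / 2) hτ
  have h2 := halfVec_dot (z - (a + b) / 2) (c + (a + b) / 2) hτ
  have h3 := halfVec_dot (z - (a + b) / 2) ((a - b) / 2) hτ
  have h4 := halfVec_dot (z + (a + b) / 2) (c + (a + b) / 2) hτ
  have h5 := halfVec_det (z + (a + b) / 2) (z - (a + b) / 2) hτ
  have h6 := halfVec_det ((a - b) / 2) (c + (a + b) / 2) hτ
  rw [show z + (a + b) / 2 + (a - b) / 2 = z + a by ring,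
    show z + (a + b) / 2 - (a - b) / 2 = z + b by ring] at h1
  rw [show z - (a + b) / 2 + (c + (a + b) / 2) = z + c by ring,
    show z - (a + b) / 2 - (c + (a + b) / 2) = z + -(a + b + c) by ring] at h2
  rw [show z - (a + b) / 2 + (a - b) / 2 = z - b by ring,
    show z - (a + b) / 2 - (a - b) / 2 = z - a by ring] at h3
  rw [show z + (a + b) / 2 + (c + (a + b) / 2) = z - -(a + b + c) by ring,
    show z + (a + b) / 2 - (c + (a + b) / 2) = z - c by ring] at h4
  rw [show z + (a + b) / 2 + (z - (a + b) / 2) = 2 * z by ring,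
    show z + (a + b) / 2 - (z - (a + b) / 2) = a + b by ring] at h5
  rw [show (a - b) / 2 + (c + (a + b) / 2) = a + c by ring,
    show (a - b) / 2 - (c + (a + b) / 2) = -(b + c) by ring] at h6
  rw [show a + -(a + b + c) = -(b + c) by ring]
  generalize halfVec τ (z + (a + b) / 2) = A at *
  generalize halfVec τ (z - (a + b) / 2) = B at *
  generalize halfVec τ ((a - b) / 2) = C at *
  generalize halfVec τ (c + (a + b) / 2) = D at *
  have e1 := congrArg₂ (· * ·) h1 h2
  have e2 := congrArg₂ (· * ·) h3 h4
  have e3 := congrArg₂ (· * ·) h5 h6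
  linear_combination (1 / 4 : ℂ) * (e3 - e1 + e2)

/-! ### Zeros of the theta functions on the real axis -/

theorem theta_zero_zero_ofReal_ne_zero (x : ℝ) {t : ℝ} (ht : 0 < t) :
    theta 0 0 x (t * I) ≠ 0 := by
  have ht' : (t : ℂ) ≠ 0 := by exact_mod_cast ht.ne'
  have h : theta 0 0 x (t * I) = jacobiTheta₂ x (t * I) := by simp [theta_eq]
  have e1 : (x : ℂ) / (t * I) = ((-x / t : ℝ) : ℂ) * I := by
    push_cast
    rw [div_eq_iff (by simp [ht'])]
    field_simp
    linear_combination (x : ℂ) * I_sq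
  have e2 : -1 / (t * I : ℂ) = ((1 / t : ℝ) : ℂ) * I := by
    push_cast
    rw [div_eq_iff (by simp [ht'])]
    field_simp
    linear_combination -I_sq
  rw [h, jacobiTheta₂_functional_equation, e1, e2]
  refine mul_ne_zero (mul_ne_zero ?_ (Complex.exp_ne_zero _))
    (jacobiTheta₂_imag_ne_zero _ (by positivity))
  have : -I * (t * I) = (t : ℂ) := by linear_combination -(t : ℂ) * I_sq
  rw [this, one_div]
  refine inv_ne_zero ?_
  rw [Complex.cpow_ne_zero_iff]
  exact Or.inl ht'

theorem theta_zero_one_ofReal_ne_zero (x : ℝ) {t : ℝ} (ht : 0 < t) :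
    theta 0 1 x (t * I) ≠ 0 := by
  rw [← theta_zero_zero_add_half]
  have := theta_zero_zero_ofReal_ne_zero (x + 1 / 2) ht
  push_cast at this
  exact this

/-- The odd theta function of degree `D` with leading Fourier mode `sin (2πz)`. -/
noncomputable def oddSine (τ : ℂ) (D : ℕ) (z : ℂ) : ℂ :=
  cexp (2 * π * I * z) * jacobiTheta₂ (2 * D * z + τ) (2 * D * τ) -
  cexp (-(2 * π * I * z)) * jacobiTheta₂ (2 * D * z - τ) (2 * D * τ)

theorem oddSine_mem {t : ℝ} (ht : 0 < t) (L : ℕ) :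
    oddSine (t * I) (L + 2) ∈ oddTheta (t * I) (L + 2) := by
  have him : 0 < (2 * (L + 2 : ℕ) * (t * I) : ℂ).im := by
    have : (2 * (L + 2 : ℕ) * (t * I) : ℂ) = ((2 * (L + 2 : ℕ) * t : ℝ) : ℂ) * I := by
      push_cast; ring
    rw [this]; simp; positivity
  have hth : Differentiable ℂ fun z => jacobiTheta₂ z (2 * (L + 2 : ℕ) * (t * I)) := fun z =>
    differentiableAt_jacobiTheta₂_fst z him
  refine ⟨?_, fun z => ?_, fun z => ?_, fun z => ?_⟩
  · have h1 : Differentiable ℂ fun z : ℂ => 2 * ((L + 2 : ℕ) : ℂ) * z + t * I := by fun_prop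
    have h2 : Differentiable ℂ fun z : ℂ => 2 * ((L + 2 : ℕ) : ℂ) * z - t * I := by fun_prop
    exact Differentiable.sub (Differentiable.mul (by fun_prop) (hth.comp h1))
      (Differentiable.mul (by fun_prop) (hth.comp h2))
  · unfold oddSine
    generalize L + 2 = D
    have e1 : (2 * D * (z + 1) + t * I : ℂ) = 2 * D * z + t * I + (2 * D : ℕ) := by
      push_cast; ring
    have e2 : (2 * D * (z + 1) - t * I : ℂ) = 2 * D * z - t * I + (2 * D : ℕ) := by
      push_cast; ring
    rw [e1, e2, jacobiTheta₂_add_nat, jacobiTheta₂_add_nat]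
    congr 2
    · rw [Complex.exp_eq_exp_iff_exists_int]; exact ⟨1, by push_cast; ring⟩
    · rw [Complex.exp_eq_exp_iff_exists_int]; exact ⟨-1, by push_cast; ring⟩
  · unfold oddSine
    generalize L + 2 = D
    have e1 : (2 * D * (-z) + t * I : ℂ) = -(2 * D * z - t * I) := by ring
    have e2 : (2 * D * (-z) - t * I : ℂ) = -(2 * D * z + t * I) := by ring
    have e3 : -(2 * π * I * -z) = 2 * π * I * z := by ring
    have e4 : 2 * π * I * -z = -(2 * π * I * z) := by ring
    rw [e1, e2, jacobiTheta₂_neg_left, jacobiTheta₂_neg_left, e3, e4]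
    ring
  · unfold oddSine
    generalize L + 2 = D
    have e1 : (2 * D * (z + t * I) + t * I : ℂ) = 2 * D * z + t * I + 2 * D * (t * I) := by ring
    have e2 : (2 * D * (z + t * I) - t * I : ℂ) = 2 * D * z - t * I + 2 * D * (t * I) := by ring
    rw [e1, e2, jacobiTheta₂_add_left', jacobiTheta₂_add_left']
    have aux : ∀ A B C D y : ℂ, A + B = C + D → cexp A * (cexp B * y) = cexp C * (cexp D * y) := by
      intro A B C D y e
      have := congrArg cexp e
      rw [Complex.exp_add, Complex.exp_add] at this
      linear_combination y * this
    refine Eq.trans ?_ (mul_sub _ _ _).symm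
    congr 1 <;> (apply aux; ring)

open Filter in
theorem tendsto_jacobiTheta₂_degree (x : ℝ) {t : ℝ} (ht : 0 < t) :
    Tendsto (fun L : ℕ => jacobiTheta₂ (2 * (L + 2 : ℕ) * x + t * I) (2 * (L + 2 : ℕ) * (t * I)))
      atTop (nhds 1) := by
  have hnorm : ∀ (L : ℕ) (n : ℤ),
      ‖jacobiTheta₂_term n (2 * (L + 2 : ℕ) * x + t * I) (2 * (L + 2 : ℕ) * (t * I))‖ =
        Real.exp (-(π * t) * (2 * (L + 2) * n ^ 2 + 2 * n)) := by
    intro L n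
    rw [norm_jacobiTheta₂_term]
    congr 1
    simp
    ring
  have hbound := (hasSum_jacobiTheta₂_term 0 (τ := t * I) (by simpa using ht)).summable.norm
  have h1 : ∑' n : ℤ, (if n = 0 then (1 : ℂ) else 0) = 1 := tsum_ite_eq 0 _
  rw [← h1]
  refine tendsto_tsum_of_dominated_convergence hbound (fun n => ?_) (Eventually.of_forall ?_)
  · rcases eq_or_ne n 0 with rfl | hn
    · simp [jacobiTheta₂_term]
    · rw [if_neg hn, tendsto_zero_iff_norm_tendsto_zero]
      simp only [hnorm]
      refine Real.tendsto_exp_atBot.comp ?_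
      have hn2 : (0 : ℝ) < (n : ℝ) ^ 2 := by positivity
      have : ∀ L : ℕ, -(π * t) * (2 * ((L : ℝ) + 2) * n ^ 2 + 2 * n) =
          -(2 * π * t * n ^ 2) * L + -(π * t) * (4 * n ^ 2 + 2 * n) := fun L => by ring
      simp only [this]
      refine tendsto_atBot_add_const_right _ _ ?_
      refine (tendsto_natCast_atTop_atTop (R := ℝ)).const_mul_atTop_of_neg ?_
      have := Real.pi_pos
      have : 0 < 2 * π * t * (n : ℝ) ^ 2 := by positivity
      linarith
  · intro L n
    rw [hnorm, norm_jacobiTheta₂_term]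
    refine Real.exp_le_exp.2 ?_
    simp only [zero_im, mul_zero, sub_zero, mul_im, ofReal_re, I_im, mul_one, ofReal_im, I_re,
      add_zero]
    have hint : (0 : ℤ) ≤ (2 * L + 3) * n ^ 2 + 2 * n := by
      rcases eq_or_ne n 0 with rfl | hn
      · simp
      · have : 0 ≤ (n + 1) ^ 2 := sq_nonneg _
        have h2 : 0 < n ^ 2 := by positivity
        have h3 : 0 ≤ (2 * (L : ℤ)) * n ^ 2 := by positivity
        nlinarith
    have hr : (0 : ℝ) ≤ (2 * L + 3) * (n : ℝ) ^ 2 + 2 * n := by exact_mod_cast hint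
    have hpt : 0 < π * t := mul_pos Real.pi_pos ht
    nlinarith [mul_nonneg hpt.le hr]

/-- On the real axis `θ₁₁` vanishes only at the integers. If `θ₁₁(2z₀) = 0`, then every odd theta
function vanishes at `z₀`, because multiplication by `θ₁₁(2z)` maps onto the odd theta functions;
for those with leading mode `sin (2πz)` the limit of large degree gives `sin (2πz₀) = 0`. -/
theorem theta_one_one_ofReal_ne_zero {x : ℝ} (hx : ∀ n : ℤ, x ≠ n) {t : ℝ} (ht : 0 < t) :
    theta 1 1 x (t * I) ≠ 0 := by
  intro h0
  have hτ : 0 < (t * I : ℂ).im := by simpa using ht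
  have hz : ∀ L : ℕ, oddSine (t * I) (L + 2) ((x / 2 : ℝ) : ℂ) = 0 := by
    intro L
    obtain ⟨f, hf⟩ := (mulTheta_bijective ht hτ rfl L).2 ⟨_, oddSine_mem ht L⟩
    have h := congrFun (congrArg Subtype.val hf) ((x / 2 : ℝ) : ℂ)
    refine h.symm.trans ?_
    change theta 1 1 (2 * ((x / 2 : ℝ) : ℂ)) (t * I) * _ = 0
    rw [show 2 * ((x / 2 : ℝ) : ℂ) = x by push_cast; ring, h0, zero_mul]
  have h1 := (tendsto_jacobiTheta₂_degree (x / 2) ht).const_mul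
    (cexp (2 * π * I * ((x / 2 : ℝ) : ℂ)))
  have h2 := (tendsto_jacobiTheta₂_degree (-(x / 2)) ht).const_mul
    (cexp (-(2 * π * I * ((x / 2 : ℝ) : ℂ))))
  have h3 := h1.sub h2
  have h4 := tendsto_nhds_unique (h3.congr fun L => (?_ : _ = (0 : ℂ))) tendsto_const_nhds
  · rw [mul_one, mul_one, sub_eq_zero, Complex.exp_eq_exp_iff_exists_int] at h4
    obtain ⟨n, hn⟩ := h4
    have hpi : (2 * π * I : ℂ) ≠ 0 := Complex.two_pi_I_ne_zero
    have : (x : ℂ) = n := by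
      refine mul_left_cancel₀ hpi ?_
      push_cast at hn
      linear_combination hn
    exact hx n (by exact_mod_cast this)
  · -- The second theta function in `oddSine` is even in its argument.
    rw [← hz L, oddSine]
    congr 2
    rw [← jacobiTheta₂_neg_left]
    congr 1
    push_cast; ring

namespace Model

variable (P : Model)

theorem two_mul_r'_div_r_ne (n : ℤ) : 2 * ((P.r' : ℝ) / P.r) ≠ n := by
  intro h
  have hr : (P.r : ℝ) ≠ 0 := by
    have := P.two_lt_r
    positivity
  have h2 : (2 * P.r' : ℝ) = n * P.r := by
    field_simp at h
    rw [h, mul_comm]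
  have h3 : 2 * P.r' = n * P.r := by exact_mod_cast h2
  have hd : (P.r : ℤ) ∣ 2 := P.coprime.dvd_of_dvd_mul_right ⟨n, by rw [h3]; ring⟩
  have := Int.le_of_dvd (by norm_num) hd
  have := P.two_lt_r
  omega

theorem thIdx_η_ne_zero (a : Fin 4) : P.thIdx a P.η ≠ 0 := by
  have ht := inv_pos.2 P.t_pos
  have hη : P.η = ((P.r' / P.r : ℝ) : ℂ) := by unfold η; push_cast; rfl
  have hne := P.two_mul_r'_div_r_ne
  fin_cases a
  · change theta 1 1 P.η P.τ ≠ 0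
    rw [hη, τ_eq]
    refine theta_one_one_ofReal_ne_zero (fun n hn => hne (2 * n) ?_) ht
    rw [hn]; push_cast; ring
  · change theta 1 0 P.η P.τ ≠ 0
    rw [hη, τ_eq, show (((P.r' / P.r : ℝ) : ℂ)) = ((P.r' / P.r - 1 / 2 : ℝ) : ℂ) + 1 / 2 by
      push_cast; ring, theta_one_zero_add_half]
    refine theta_one_one_ofReal_ne_zero (fun n hn => hne (2 * n + 1) ?_) ht
    push_cast
    linear_combination 2 * hn
  · change theta 0 0 P.η P.τ ≠ 0
    rw [hη, τ_eq]
    exact theta_zero_zero_ofReal_ne_zero _ ht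
  · change theta 0 1 P.η P.τ ≠ 0
    rw [hη, τ_eq]
    exact theta_zero_one_ofReal_ne_zero _ ht

/-! ### The local `L` operator and the gauge transformation -/

/-- The matrix entries of the local `L` operator `Σ_a W_a^L(λ) ρ(S^a) ⊗ σ^a`, acting on a single
tensor factor. -/
noncomputable def locL (lam : ℂ) (i j : Fin 2) : Module.End ℂ P.V :=
  ∑ a : Fin 4, (P.WL a lam * pauli a i j) • P.rho a

/-- The coefficient matrix of the `L` operator has rank one. -/
theorem sum_thIdx_mul_pauli (lam y : ℂ) (i j : Fin 2) :
    ∑ a : Fin 4, ![1, 1, I, 1] a * P.thIdx a lam * P.thIdx a (2 * y) * pauli a i j =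
      ![halfVec P.τ (lam / 2 - y) 1, -halfVec P.τ (lam / 2 - y) 0] i *
        halfVec P.τ (lam / 2 + y) j := by
  have hτ := im_div_two_pos P.τ_im
  have e1 : lam / 2 + y + (lam / 2 - y) = lam := by ring
  have e2 : lam / 2 + y - (lam / 2 - y) = 2 * y := by ring
  have h1 := theta_zero_zero_mul_theta_zero_zero (lam / 2 + y) (lam / 2 - y) hτ
  have h2 := theta_zero_one_mul_theta_zero_one (lam / 2 + y) (lam / 2 - y) hτ
  have h3 := theta_zero_one_mul_theta_zero_zero (lam / 2 + y) (lam / 2 - y) hτ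
  have h4 := theta_zero_zero_mul_theta_zero_one (lam / 2 + y) (lam / 2 - y) hτ
  rw [e1, e2, mul_div_cancel₀ _ two_ne_zero] at h1 h2 h3 h4
  fin_cases i <;> fin_cases j <;>
    simp [Fin.sum_univ_four, thIdx, pauli, halfVec, th]
  · linear_combination -h3
  · linear_combination -h1 - theta 0 0 lam P.τ * theta 0 0 (2 * y) P.τ * I_sq
  · linear_combination h2 + theta 0 0 lam P.τ * theta 0 0 (2 * y) P.τ * I_sq
  · linear_combination h4

theorem locL_spec (lam : ℂ) (i j : Fin 2) (f : P.V) (z : ℂ) :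
    P.th 1 1 (2 * z) * (P.locL lam i j f).1 z =
      ![halfVec P.τ (lam / 2 - (z - P.ℓ * P.η)) 1, -halfVec P.τ (lam / 2 - (z - P.ℓ * P.η)) 0] i *
          halfVec P.τ (lam / 2 + (z - P.ℓ * P.η)) j * f.1 (z + P.η) -
        ![halfVec P.τ (lam / 2 - (-z - P.ℓ * P.η)) 1,
            -halfVec P.τ (lam / 2 - (-z - P.ℓ * P.η)) 0] i *
          halfVec P.τ (lam / 2 + (-z - P.ℓ * P.η)) j * f.1 (z - P.η) := by
  have h : (P.locL lam i j f).1 z = ∑ a : Fin 4, P.WL a lam * pauli a i j * (P.rho a f).1 z := by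
    simp [locL, Fin.sum_univ_four]
  rw [h, Finset.mul_sum, ← sum_thIdx_mul_pauli, ← sum_thIdx_mul_pauli, Finset.sum_mul,
    Finset.sum_mul, ← Finset.sum_sub_distrib]
  refine Finset.sum_congr rfl fun a _ => ?_
  have hη := P.thIdx_η_ne_zero a
  have hs := P.rho_spec a f z
  rw [mul_left_comm, hs]
  unfold WL sFun
  field_simp

variable (sp sm : ℂ)

/-- The scalar by which the columns of the gauge transformation differ from values of
`halfVec`. -/
noncomputable def gaugeConst : ℂ := (1 / (2 * P.t) : ℂ) ^ (1 / 2 : ℂ)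

theorem gaugeConst_ne_zero : P.gaugeConst ≠ 0 := by
  unfold gaugeConst
  rw [Complex.cpow_ne_zero_iff]
  have : (P.t : ℂ) ≠ 0 := by exact_mod_cast P.t_pos.ne'
  simp [this]

/-- Jacobi's imaginary transformation of the gauge vectors. -/
theorem gauge_column (x : ℂ) :
    ![theta 1 1 (-I * P.t * x) (2 * I * P.t), theta 0 1 (-I * P.t * x) (2 * I * P.t)] =
      fun i => P.gaugeConst * cexp (π * I * x) * halfVec P.τ (x / 2 + P.τ / 4) i *
        (cexp (-(π * P.t / 2) * (x - I / (2 * P.t)) ^ 2))⁻¹ := by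
  have ht : (P.t : ℂ) ≠ 0 := by exact_mod_cast P.t_pos.ne'
  have hC := P.gaugeConst_ne_zero
  have hfun : ∀ v : ℂ, jacobiTheta₂ v (P.τ / 2) =
      P.gaugeConst⁻¹ * cexp (-(2 * π * P.t) * v ^ 2) *
        jacobiTheta₂ (-(2 * I * P.t * v)) (2 * I * P.t) := by
    intro v
    have hI : (I : ℂ) ≠ 0 := I_ne_zero
    rw [jacobiTheta₂_functional_equation, gaugeConst, ← one_div]
    have e1 : -I * (P.τ / 2) = 1 / (2 * P.t) := by
      unfold τ; field_simp; linear_combination -I_sq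
    have e2 : -π * I * v ^ 2 / (P.τ / 2) = -(2 * π * P.t) * v ^ 2 := by
      unfold τ; field_simp
    have e3 : v / (P.τ / 2) = -(2 * I * P.t * v) := by
      unfold τ; field_simp; linear_combination v * I_sq
    have e4 : -1 / (P.τ / 2) = 2 * I * P.t := by
      unfold τ; field_simp; linear_combination -I_sq
    rw [e1, e2, e3, e4]
  have hIt : I * P.t * P.τ = -1 := by
    unfold τ; field_simp; exact I_sq
  have hτ4 : P.τ = I / P.t := rfl
  have key : ∀ A B D F y : ℂ, A = B + (D + F) →
      cexp A * y = cexp B * (cexp D * (cexp F * y)) := by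
    intro A B D F y e
    rw [e, Complex.exp_add, Complex.exp_add]
    ring
  funext i
  rw [eq_mul_inv_iff_mul_eq₀ (Complex.exp_ne_zero _)]
  fin_cases i
  · change theta 1 1 (-I * P.t * x) (2 * I * P.t) * _ =
      _ * theta 0 1 (x / 2 + P.τ / 4) (P.τ / 2)
    have e1 : -(2 * I * P.t * (x / 2 + P.τ / 4 + 1 / 2)) = -I * P.t * x + 1 / 2 - I * P.t := by
      linear_combination -(1 / 2 : ℂ) * hIt
    have e2 : -I * P.t * x + 1 / 2 + 1 / 2 * (2 * I * P.t) =
        -I * P.t * x + 1 / 2 - I * P.t + 2 * I * P.t := by ring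
    rw [← theta_zero_zero_add_half]
    simp only [theta_eq, Nat.cast_one, Nat.cast_zero, zero_div, zero_mul, add_zero]
    rw [hfun, e1, e2, jacobiTheta₂_add_left']
    generalize jacobiTheta₂ (-I * P.t * x + 1 / 2 - I * P.t) (2 * I * P.t) = J
    rw [show ∀ a b d : ℂ, P.gaugeConst * a * (b * (P.gaugeConst⁻¹ * d * J)) = a * (b * (d * J)) by
      intro a b d; field_simp]
    rw [mul_comm, ← mul_assoc, ← mul_assoc, ← Complex.exp_add, ← Complex.exp_add]
    refine key _ _ _ _ _ ?_
    rw [hτ4]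
    field_simp
    ring_nf
    simp only [I_sq]
    ring
  · change theta 0 1 (-I * P.t * x) (2 * I * P.t) * _ =
      _ * theta 0 0 (x / 2 + P.τ / 4) (P.τ / 2)
    have e1 : -(2 * I * P.t * (x / 2 + P.τ / 4)) = -I * P.t * x + 1 / 2 := by
      linear_combination -(1 / 2 : ℂ) * hIt
    rw [← theta_zero_zero_add_half]
    simp only [theta_eq, Nat.cast_zero, zero_div, zero_mul, add_zero]
    rw [hfun, e1]
    generalize jacobiTheta₂ (-I * P.t * x + 1 / 2) (2 * I * P.t) = J
    rw [show ∀ a b d : ℂ, P.gaugeConst * a * (b * (P.gaugeConst⁻¹ * d * J)) = a * (b * (d * J)) by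
      intro a b d; field_simp]
    rw [mul_comm, ← mul_assoc, ← Complex.exp_add]
    refine key _ _ _ _ _ ?_
    rw [hτ4]
    field_simp
    ring

theorem gauge_apply (k : ℤ) (lam : ℂ) (i j : Fin 2) :
    P.gauge sp sm k lam i j =
      ![P.gaugeConst * cexp (π * I * (sp - lam + 2 * k * P.η)) *
          halfVec P.τ ((sp - lam) / 2 + k * P.η + P.τ / 4) i,
        P.gaugeConst * cexp (π * I * (sm + lam + 2 * k * P.η)) *
          halfVec P.τ ((sm + lam) / 2 + k * P.η + P.τ / 4) i * (P.th 1 1 (P.w sp sm k))⁻¹] j := by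
  have h1 := congrFun (P.gauge_column (sp - lam + 2 * k * P.η)) i
  have h2 := congrFun (P.gauge_column (sm + lam + 2 * k * P.η)) i
  rw [show (sp - lam + 2 * k * P.η) / 2 = (sp - lam) / 2 + k * P.η by ring] at h1
  rw [show (sm + lam + 2 * k * P.η) / 2 = (sm + lam) / 2 + k * P.η by ring] at h2
  have x1 := Complex.exp_ne_zero (-(π * P.t / 2) * (sp - lam + 2 * k * P.η - I / (2 * P.t)) ^ 2)
  have x2 := Complex.exp_ne_zero (-(π * P.t / 2) * (sm + lam + 2 * k * P.η - I / (2 * P.t)) ^ 2)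
  fin_cases i <;> fin_cases j <;>
    simp [gauge, Matrix.mul_apply, Fin.sum_univ_two] at h1 h2 ⊢ <;> simp only [h1, h2] <;>
      field_simp <;> simp

/-! ### Products of theta functions in the intertwining vectors -/

/-- The even product `∏_{j < n} θ₀₀(z + A + 2jη) θ₀₀(z - A - 2jη)`, from which the intertwining
vectors are built. -/
noncomputable def evenProd (n : ℕ) (A z : ℂ) : ℂ :=
  ∏ j ∈ Finset.range n, (P.th 0 0 (z + (A + 2 * j * P.η)) * P.th 0 0 (z - (A + 2 * j * P.η)))

theorem th_zero_zero_neg (z : ℂ) : P.th 0 0 (-z) = P.th 0 0 z := theta_zero_zero_neg z _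

theorem th_one_one_neg (z : ℂ) : P.th 1 1 (-z) = -P.th 1 1 z := theta_one_one_neg z _

theorem evenProd_neg (n : ℕ) (A z : ℂ) : P.evenProd n A (-z) = P.evenProd n A z := by
  refine Finset.prod_congr rfl fun j _ => ?_
  rw [show -z + (A + 2 * j * P.η) = -(z - (A + 2 * j * P.η)) by ring,
    show -z - (A + 2 * j * P.η) = -(z + (A + 2 * j * P.η)) by ring, th_zero_zero_neg,
    th_zero_zero_neg, mul_comm]

theorem evenProd_succ (n : ℕ) (A z : ℂ) : P.evenProd (n + 1) A z =
    P.evenProd n A z * (P.th 0 0 (z + (A + 2 * n * P.η)) * P.th 0 0 (z - (A + 2 * n * P.η))) :=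
  Finset.prod_range_succ _ _

theorem evenProd_succ_shift (n : ℕ) (A z : ℂ) : P.evenProd (n + 1) (A + P.η) (z + P.η) =
    P.evenProd n (A + P.η) (z + P.η) * (P.th 0 0 (z + (A + 2 * (n + 1) * P.η)) *
      P.th 0 0 (z - (A + 2 * n * P.η))) := by
  rw [evenProd_succ]
  congr 3 <;> ring

/-- Shifting the argument by `η` moves the factors of an even product past each other; one boundary
factor on each side remains. -/
theorem evenProd_shift_mul_left (n : ℕ) (A z : ℂ) :
    P.evenProd n (A + P.η) (z + P.η) * P.th 0 0 (z + A) =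
      P.evenProd n A z * P.th 0 0 (z + (A + 2 * n * P.η)) := by
  induction n with
  | zero => simp [evenProd]
  | succ n ih =>
    rw [evenProd_succ_shift, evenProd_succ]
    push_cast
    linear_combination P.th 0 0 (z + (A + 2 * (n + 1) * P.η)) *
      P.th 0 0 (z - (A + 2 * n * P.η)) * ih

theorem evenProd_shift_mul_right (n : ℕ) (A z : ℂ) :
    P.evenProd n (A + P.η) (z + P.η) * P.th 0 0 (z - (A + 2 * n * P.η)) =
      P.evenProd n (A + 2 * P.η) z * P.th 0 0 (z - A) := by
  induction n with
  | zero => simp [evenProd]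
  | succ n ih =>
    rw [evenProd_succ_shift, evenProd_succ,
      show A + 2 * P.η + 2 * n * P.η = A + 2 * (n + 1) * P.η by ring]
    push_cast
    linear_combination P.th 0 0 (z + (A + 2 * (n + 1) * P.η)) *
      P.th 0 0 (z - (A + 2 * (n + 1) * P.η)) * ih

theorem evenProd_succ_shift_eq (n : ℕ) (A z : ℂ) :
    P.evenProd (n + 1) (A + P.η) (z + P.η) = P.evenProd n (A + 2 * P.η) z *
      (P.th 0 0 (z + (A + 2 * (n + 1 : ℕ) * P.η)) * P.th 0 0 (z - A)) := by
  rw [evenProd_succ_shift]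
  push_cast
  linear_combination P.th 0 0 (z + (A + 2 * (n + 1) * P.η)) * P.evenProd_shift_mul_right n A z

/-- The product of theta functions which arises when the `L` operator is applied to a function `f`
and contracted with `halfVec v'` on the right and with the complement of `halfVec v` on the
left. -/
noncomputable def contraction (lam v v' : ℂ) (f : ℂ → ℂ) (z : ℂ) : ℂ :=
  P.th 0 0 (lam / 2 - z + P.ℓ * P.η + v) * P.th 0 0 (lam / 2 - z + P.ℓ * P.η - v) *
    P.th 0 0 (lam / 2 + z - P.ℓ * P.η + v') * P.th 0 0 (lam / 2 + z - P.ℓ * P.η - v') *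
    f (z + P.η)

/-- The `L` operator acts by a difference operator whose coefficients have rank one. Contracting
both sides with values of `halfVec` makes the action the odd part of a product of theta
functions. -/
theorem locL_contraction (lam v v' : ℂ) (f : P.V) (z : ℂ) :
    P.th 1 1 (2 * z) * ((P.locL lam 0 0 f).1 z * halfVec P.τ v' 0 +
        (P.locL lam 0 1 f).1 z * halfVec P.τ v' 1) * halfVec P.τ v 1 -
      P.th 1 1 (2 * z) * ((P.locL lam 1 0 f).1 z * halfVec P.τ v' 0 +
        (P.locL lam 1 1 f).1 z * halfVec P.τ v' 1) * halfVec P.τ v 0 =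
      4 * (P.contraction lam v v' f.1 z - P.contraction lam v v' f.1 (-z)) := by
  have hq1 := halfVec_dot (lam / 2 - (z - P.ℓ * P.η)) v P.τ_im
  have hp1 := halfVec_dot (lam / 2 + (z - P.ℓ * P.η)) v' P.τ_im
  have hq2 := halfVec_dot (lam / 2 - (-z - P.ℓ * P.η)) v P.τ_im
  have hp2 := halfVec_dot (lam / 2 + (-z - P.ℓ * P.η)) v' P.τ_im
  have h00 := P.locL_spec lam 0 0 f z
  have h01 := P.locL_spec lam 0 1 f z
  have h10 := P.locL_spec lam 1 0 f z
  have h11 := P.locL_spec lam 1 1 f z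
  simp only [Matrix.cons_val_zero, Matrix.cons_val_one] at h00 h01 h10 h11
  have hf : f.1 (-z + P.η) = f.1 (z - P.η) := by
    rw [show z - P.η = -(-z + P.η) by ring, f.2.2.2.1]
  unfold contraction
  rw [hf]
  simp only [th] at *
  rw [show lam / 2 - z + P.ℓ * P.η = lam / 2 - (z - P.ℓ * P.η) by ring,
    show lam / 2 + z - P.ℓ * P.η = lam / 2 + (z - P.ℓ * P.η) by ring,
    show lam / 2 - -z + P.ℓ * P.η = lam / 2 - (-z - P.ℓ * P.η) by ring,
    show lam / 2 + -z - P.ℓ * P.η = lam / 2 + (-z - P.ℓ * P.η) by ring]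
  have e1 := congrArg₂ (· * ·) hq1 hp1
  have e2 := congrArg₂ (· * ·) hq2 hp2
  linear_combination halfVec P.τ v' 0 * halfVec P.τ v 1 * h00 +
    halfVec P.τ v' 1 * halfVec P.τ v 1 * h01 - halfVec P.τ v' 0 * halfVec P.τ v 0 * h10 -
    halfVec P.τ v' 1 * halfVec P.τ v 0 * h11 + f.1 (z + P.η) * e1 - f.1 (z - P.η) * e2

/-- If `H` is the product of an even function and four shifted theta functions whose shifts add up
to zero, then its odd part is a product. -/
theorem odd_part_eq {H K : ℂ → ℂ} (a b c d : ℂ) {x₁ x₂ x₃ : ℂ} (hK : ∀ z, K (-z) = K z)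
    (hsum : a + b + c + d = 0) (h₁ : a + b = x₁) (h₂ : a + c = x₂) (h₃ : a + d = x₃)
    (hH : ∀ z, H z = K z *
      (P.th 0 0 (z + a) * P.th 0 0 (z + b) * P.th 0 0 (z + c) * P.th 0 0 (z + d))) (z : ℂ) :
    H z - H (-z) = P.th 1 1 (2 * z) *
      (K z * (P.th 1 1 x₁ * P.th 1 1 x₂ * P.th 1 1 x₃)) := by
  have h : ∀ x, P.th 0 0 (-z + x) = P.th 0 0 (z - x) := fun x => by
    rw [← th_zero_zero_neg]; congr 1; ring
  have key := theta_prod_sub_theta_prod P.τ_im z a b c d hsum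
  rw [hH, hH, hK, h, h, h, h, ← h₁, ← h₂, ← h₃]
  unfold th
  linear_combination K z * key

theorem th_zero_zero_congr_neg {x y : ℂ} (h : x = -y) : P.th 0 0 x = P.th 0 0 y := by
  rw [h, th_zero_zero_neg]

/-- The function `∏ θ₀₀(z ± u_j) ∏ θ₀₀(z ± v_j)` of an intertwining vector without its scalar
prefactor, with `n` factors of the first kind and `m` of the second. -/
noncomputable def phiProd (n m : ℕ) (A B z : ℂ) : ℂ := P.evenProd n A z * P.evenProd m B z

theorem phiProd_neg (n m : ℕ) (A B z : ℂ) : P.phiProd n m A B (-z) = P.phiProd n m A B z := by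
  simp only [phiProd, evenProd_neg]

/-! ### Odd parts of the contractions

In the names below, the two directions are the changes of the heights `k` and `k'` in the resulting
intertwining vector. The cases with `_zero` are those in which the new heights are not admissible.
-/

section Contraction

variable {S R lam κ κ' : ℂ}

theorem contraction_down_down {n m : ℕ} (h1 : (n : ℂ) + m = 2 * P.ℓ) (h2 : κ - κ' = n - m)
    {H : ℂ → ℂ} (hH : H = P.contraction lam (R + lam / 2 + κ * P.η) (S - lam / 2 + κ' * P.η)
      (P.phiProd n m (S + (κ' - P.ℓ) * P.η + P.η) (R + (κ - P.ℓ) * P.η + P.η))) (z : ℂ) :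
    H z - H (-z) = P.th 1 1 (2 * z) *
      (P.phiProd n m (S + (κ' - P.ℓ) * P.η) (R + (κ - P.ℓ) * P.η) z *
        (P.th 1 1 (S + R + (κ + κ' + 2 * P.ℓ) * P.η) * P.th 1 1 (S - R - lam) *
          P.th 1 1 (lam + (κ - κ') * P.η))) := by
  refine P.odd_part_eq (S + (κ + P.ℓ) * P.η) (R + (κ' + P.ℓ) * P.η)
    (-(lam + R + (κ + P.ℓ) * P.η)) (lam - S - (κ' + P.ℓ) * P.η) (P.phiProd_neg _ _ _ _)
    (by ring) (by ring) (by ring) (by ring) (fun z => ?_) z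
  have A1 := P.evenProd_shift_mul_left n (S + (κ' - P.ℓ) * P.η) z
  have A2 := P.evenProd_shift_mul_left m (R + (κ - P.ℓ) * P.η) z
  rw [show S + (κ' - P.ℓ) * P.η + 2 * n * P.η = S + (κ + P.ℓ) * P.η by
    linear_combination P.η * (h1 - h2)] at A1
  rw [show R + (κ - P.ℓ) * P.η + 2 * m * P.η = R + (κ' + P.ℓ) * P.η by
    linear_combination P.η * (h1 + h2)] at A2
  have t1 : P.th 0 0 (lam / 2 - z + P.ℓ * P.η + (R + lam / 2 + κ * P.η)) =
      P.th 0 0 (z + -(lam + R + (κ + P.ℓ) * P.η)) := P.th_zero_zero_congr_neg (by ring)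
  have t2 : P.th 0 0 (lam / 2 - z + P.ℓ * P.η - (R + lam / 2 + κ * P.η)) =
      P.th 0 0 (z + (R + (κ - P.ℓ) * P.η)) := P.th_zero_zero_congr_neg (by ring)
  have t3 : lam / 2 + z - P.ℓ * P.η + (S - lam / 2 + κ' * P.η) = z + (S + (κ' - P.ℓ) * P.η) := by
    ring
  have t4 : lam / 2 + z - P.ℓ * P.η - (S - lam / 2 + κ' * P.η) =
      z + (lam - S - (κ' + P.ℓ) * P.η) := by ring
  rw [hH]
  unfold contraction phiProd
  rw [t1, t2, t3, t4]
  linear_combination P.th 0 0 (z + -(lam + R + (κ + P.ℓ) * P.η)) *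
    P.th 0 0 (z + (lam - S - (κ' + P.ℓ) * P.η)) *
    (P.evenProd m (R + (κ - P.ℓ) * P.η + P.η) (z + P.η) *
      P.th 0 0 (z + (R + (κ - P.ℓ) * P.η)) * A1 +
     P.evenProd n (S + (κ' - P.ℓ) * P.η) z * P.th 0 0 (z + (S + (κ + P.ℓ) * P.η)) * A2)

theorem contraction_up_up {n m : ℕ} (h1 : (n : ℂ) + m = 2 * P.ℓ) (h2 : κ - κ' = n - m)
    {H : ℂ → ℂ} (hH : H = P.contraction lam (S - lam / 2 + κ * P.η) (R + lam / 2 + κ' * P.η)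
      (P.phiProd n m (S + (κ' - P.ℓ) * P.η + P.η) (R + (κ - P.ℓ) * P.η + P.η))) (z : ℂ) :
    H z - H (-z) = P.th 1 1 (2 * z) *
      (P.phiProd n m (S + (κ' - P.ℓ) * P.η + 2 * P.η) (R + (κ - P.ℓ) * P.η + 2 * P.η) z *
        (P.th 1 1 (-(S + R + (κ + κ' - 2 * P.ℓ) * P.η)) * P.th 1 1 (-(lam - (κ - κ') * P.η)) *
          P.th 1 1 (R - S + lam))) := by
  refine P.odd_part_eq (-(S + (κ' - P.ℓ) * P.η)) (-(R + (κ - P.ℓ) * P.η))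
    (-(lam - S - (κ - P.ℓ) * P.η)) (lam + R + (κ' - P.ℓ) * P.η) (P.phiProd_neg _ _ _ _)
    (by ring) (by ring) (by ring) (by ring) (fun z => ?_) z
  have A1 := P.evenProd_shift_mul_right n (S + (κ' - P.ℓ) * P.η) z
  have A2 := P.evenProd_shift_mul_right m (R + (κ - P.ℓ) * P.η) z
  rw [show S + (κ' - P.ℓ) * P.η + 2 * n * P.η = S + (κ + P.ℓ) * P.η by
    linear_combination P.η * (h1 - h2)] at A1
  rw [show R + (κ - P.ℓ) * P.η + 2 * m * P.η = R + (κ' + P.ℓ) * P.η by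
    linear_combination P.η * (h1 + h2)] at A2
  have t1 : P.th 0 0 (lam / 2 - z + P.ℓ * P.η + (S - lam / 2 + κ * P.η)) =
      P.th 0 0 (z - (S + (κ + P.ℓ) * P.η)) := P.th_zero_zero_congr_neg (by ring)
  have t2 : P.th 0 0 (lam / 2 - z + P.ℓ * P.η - (S - lam / 2 + κ * P.η)) =
      P.th 0 0 (z + -(lam - S - (κ - P.ℓ) * P.η)) := P.th_zero_zero_congr_neg (by ring)
  have t3 : lam / 2 + z - P.ℓ * P.η + (R + lam / 2 + κ' * P.η) =
      z + (lam + R + (κ' - P.ℓ) * P.η) := by ring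
  have t4 : lam / 2 + z - P.ℓ * P.η - (R + lam / 2 + κ' * P.η) =
      z - (R + (κ' + P.ℓ) * P.η) := by ring
  rw [hH]
  unfold contraction phiProd
  rw [t1, t2, t3, t4, ← sub_eq_add_neg z (S + (κ' - P.ℓ) * P.η),
    ← sub_eq_add_neg z (R + (κ - P.ℓ) * P.η)]
  linear_combination P.th 0 0 (z + -(lam - S - (κ - P.ℓ) * P.η)) *
    P.th 0 0 (z + (lam + R + (κ' - P.ℓ) * P.η)) *
    (P.evenProd m (R + (κ - P.ℓ) * P.η + P.η) (z + P.η) *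
      P.th 0 0 (z - (R + (κ' + P.ℓ) * P.η)) * A1 +
     P.evenProd n (S + (κ' - P.ℓ) * P.η + 2 * P.η) z * P.th 0 0 (z - (S + (κ' - P.ℓ) * P.η)) * A2)

theorem contraction_up_down {n m : ℕ} (h1 : (n : ℂ) + (m + 1 : ℕ) = 2 * P.ℓ)
    (h2 : κ - κ' = n - (m + 1 : ℕ))
    {H : ℂ → ℂ} (hH : H = P.contraction lam (S - lam / 2 + κ * P.η) (S - lam / 2 + κ' * P.η)
      (P.phiProd n (m + 1) (S + (κ' - P.ℓ) * P.η + P.η) (R + (κ - P.ℓ) * P.η + P.η))) (z : ℂ) :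
    H z - H (-z) = P.th 1 1 (2 * z) *
      (P.phiProd (n + 1) m (S + (κ' - P.ℓ) * P.η) (R + (κ - P.ℓ) * P.η + 2 * P.η) z *
        (P.th 1 1 (-((κ - κ' - 2 * P.ℓ) * P.η)) * P.th 1 1 (S + R + (κ + κ') * P.η - lam) *
          P.th 1 1 (R - S + lam))) := by
  refine P.odd_part_eq (R + (κ' + P.ℓ) * P.η) (-(R + (κ - P.ℓ) * P.η))
    (-(lam - S - (κ - P.ℓ) * P.η)) (lam - S - (κ' + P.ℓ) * P.η) (P.phiProd_neg _ _ _ _)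
    (by ring) (by ring) (by ring) (by ring) (fun z => ?_) z
  have A1 := P.evenProd_shift_mul_left n (S + (κ' - P.ℓ) * P.η) z
  have A2 := P.evenProd_succ_shift_eq m (R + (κ - P.ℓ) * P.η) z
  have A3 := P.evenProd_succ n (S + (κ' - P.ℓ) * P.η) z
  rw [show S + (κ' - P.ℓ) * P.η + 2 * n * P.η = S + (κ + P.ℓ) * P.η by
    linear_combination P.η * (h1 - h2)] at A1 A3
  rw [show R + (κ - P.ℓ) * P.η + 2 * (m + 1 : ℕ) * P.η = R + (κ' + P.ℓ) * P.η by
    linear_combination P.η * (h1 + h2)] at A2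
  have t1 : P.th 0 0 (lam / 2 - z + P.ℓ * P.η + (S - lam / 2 + κ * P.η)) =
      P.th 0 0 (z - (S + (κ + P.ℓ) * P.η)) := P.th_zero_zero_congr_neg (by ring)
  have t2 : P.th 0 0 (lam / 2 - z + P.ℓ * P.η - (S - lam / 2 + κ * P.η)) =
      P.th 0 0 (z + -(lam - S - (κ - P.ℓ) * P.η)) := P.th_zero_zero_congr_neg (by ring)
  have t3 : lam / 2 + z - P.ℓ * P.η + (S - lam / 2 + κ' * P.η) = z + (S + (κ' - P.ℓ) * P.η) := by
    ring
  have t4 : lam / 2 + z - P.ℓ * P.η - (S - lam / 2 + κ' * P.η) =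
      z + (lam - S - (κ' + P.ℓ) * P.η) := by ring
  rw [hH]
  unfold contraction phiProd
  rw [t1, t2, t3, t4, ← sub_eq_add_neg z (R + (κ - P.ℓ) * P.η), A2, A3]
  linear_combination P.th 0 0 (z + -(lam - S - (κ - P.ℓ) * P.η)) *
    P.th 0 0 (z + (lam - S - (κ' + P.ℓ) * P.η)) * P.th 0 0 (z - (S + (κ + P.ℓ) * P.η)) *
    P.evenProd m (R + (κ - P.ℓ) * P.η + 2 * P.η) z * P.th 0 0 (z + (R + (κ' + P.ℓ) * P.η)) *
    P.th 0 0 (z - (R + (κ - P.ℓ) * P.η)) * A1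

theorem contraction_up_down_zero {n : ℕ} (h1 : (n : ℂ) = 2 * P.ℓ) (h2 : κ - κ' = n)
    {H : ℂ → ℂ} (hH : H = P.contraction lam (S - lam / 2 + κ * P.η) (S - lam / 2 + κ' * P.η)
      (P.phiProd n 0 (S + (κ' - P.ℓ) * P.η + P.η) (R + (κ - P.ℓ) * P.η + P.η))) (z : ℂ) :
    H z - H (-z) = 0 := by
  have key : ∀ z, H z = P.phiProd (n + 1) 0 (S + (κ' - P.ℓ) * P.η) 0 z *
      (P.th 0 0 (z + (lam - S - (κ' + P.ℓ) * P.η)) *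
        P.th 0 0 (z - (lam - S - (κ' + P.ℓ) * P.η))) := by
    intro z
    have A1 := P.evenProd_shift_mul_left n (S + (κ' - P.ℓ) * P.η) z
    have A3 := P.evenProd_succ n (S + (κ' - P.ℓ) * P.η) z
    rw [show S + (κ' - P.ℓ) * P.η + 2 * n * P.η = S + (κ + P.ℓ) * P.η by
      linear_combination P.η * (h1 - h2)] at A1 A3
    have t1 : P.th 0 0 (lam / 2 - z + P.ℓ * P.η + (S - lam / 2 + κ * P.η)) =
        P.th 0 0 (z - (S + (κ + P.ℓ) * P.η)) := P.th_zero_zero_congr_neg (by ring)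
    have t2 : P.th 0 0 (lam / 2 - z + P.ℓ * P.η - (S - lam / 2 + κ * P.η)) =
        P.th 0 0 (z - (lam - S - (κ' + P.ℓ) * P.η)) :=
      P.th_zero_zero_congr_neg (by linear_combination -P.η * (h1 + h2))
    have t3 : lam / 2 + z - P.ℓ * P.η + (S - lam / 2 + κ' * P.η) =
        z + (S + (κ' - P.ℓ) * P.η) := by ring
    have t4 : lam / 2 + z - P.ℓ * P.η - (S - lam / 2 + κ' * P.η) =
        z + (lam - S - (κ' + P.ℓ) * P.η) := by ring
    rw [hH]
    unfold contraction phiProd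
    rw [t1, t2, t3, t4, A3]
    simp only [evenProd, Finset.range_zero, Finset.prod_empty, mul_one] at A1 ⊢
    linear_combination P.th 0 0 (z - (S + (κ + P.ℓ) * P.η)) *
      P.th 0 0 (z + (lam - S - (κ' + P.ℓ) * P.η)) *
      P.th 0 0 (z - (lam - S - (κ' + P.ℓ) * P.η)) * A1
  rw [key, key, phiProd_neg, sub_eq_zero, mul_comm (P.th 0 0 (z + _))]
  congr 2 <;> exact P.th_zero_zero_congr_neg (by ring)

theorem contraction_down_up {n m : ℕ} (h1 : ((n + 1 : ℕ) : ℂ) + m = 2 * P.ℓ)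
    (h2 : κ - κ' = (n + 1 : ℕ) - m)
    {H : ℂ → ℂ} (hH : H = P.contraction lam (R + lam / 2 + κ * P.η) (R + lam / 2 + κ' * P.η)
      (P.phiProd (n + 1) m (S + (κ' - P.ℓ) * P.η + P.η) (R + (κ - P.ℓ) * P.η + P.η))) (z : ℂ) :
    H z - H (-z) = P.th 1 1 (2 * z) *
      (P.phiProd n (m + 1) (S + (κ' - P.ℓ) * P.η + 2 * P.η) (R + (κ - P.ℓ) * P.η) z *
        (P.th 1 1 (-((κ' - κ - 2 * P.ℓ) * P.η)) * P.th 1 1 (S - R - lam) *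
          P.th 1 1 (S + R + (κ + κ') * P.η + lam))) := by
  refine P.odd_part_eq (S + (κ + P.ℓ) * P.η) (-(S + (κ' - P.ℓ) * P.η))
    (-(lam + R + (κ + P.ℓ) * P.η)) (lam + R + (κ' - P.ℓ) * P.η) (P.phiProd_neg _ _ _ _)
    (by ring) (by ring) (by ring) (by ring) (fun z => ?_) z
  have A1 := P.evenProd_succ_shift_eq n (S + (κ' - P.ℓ) * P.η) z
  have A2 := P.evenProd_shift_mul_left m (R + (κ - P.ℓ) * P.η) z
  have A3 := P.evenProd_succ m (R + (κ - P.ℓ) * P.η) z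
  rw [show S + (κ' - P.ℓ) * P.η + 2 * (n + 1 : ℕ) * P.η = S + (κ + P.ℓ) * P.η by
    linear_combination P.η * (h1 - h2)] at A1
  rw [show R + (κ - P.ℓ) * P.η + 2 * m * P.η = R + (κ' + P.ℓ) * P.η by
    linear_combination P.η * (h1 + h2)] at A2 A3
  have t1 : P.th 0 0 (lam / 2 - z + P.ℓ * P.η + (R + lam / 2 + κ * P.η)) =
      P.th 0 0 (z + -(lam + R + (κ + P.ℓ) * P.η)) := P.th_zero_zero_congr_neg (by ring)
  have t2 : P.th 0 0 (lam / 2 - z + P.ℓ * P.η - (R + lam / 2 + κ * P.η)) =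
      P.th 0 0 (z + (R + (κ - P.ℓ) * P.η)) := P.th_zero_zero_congr_neg (by ring)
  have t3 : lam / 2 + z - P.ℓ * P.η + (R + lam / 2 + κ' * P.η) =
      z + (lam + R + (κ' - P.ℓ) * P.η) := by ring
  have t4 : lam / 2 + z - P.ℓ * P.η - (R + lam / 2 + κ' * P.η) =
      z - (R + (κ' + P.ℓ) * P.η) := by ring
  rw [hH]
  unfold contraction phiProd
  rw [t1, t2, t3, t4, ← sub_eq_add_neg z (S + (κ' - P.ℓ) * P.η), A1, A3]
  linear_combination P.th 0 0 (z + -(lam + R + (κ + P.ℓ) * P.η)) *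
    P.th 0 0 (z + (lam + R + (κ' - P.ℓ) * P.η)) * P.th 0 0 (z - (R + (κ' + P.ℓ) * P.η)) *
    P.evenProd n (S + (κ' - P.ℓ) * P.η + 2 * P.η) z * P.th 0 0 (z + (S + (κ + P.ℓ) * P.η)) *
    P.th 0 0 (z - (S + (κ' - P.ℓ) * P.η)) * A2

theorem contraction_down_up_zero {m : ℕ} (h1 : (m : ℂ) = 2 * P.ℓ) (h2 : κ - κ' = -m)
    {H : ℂ → ℂ} (hH : H = P.contraction lam (R + lam / 2 + κ * P.η) (R + lam / 2 + κ' * P.η)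
      (P.phiProd 0 m (S + (κ' - P.ℓ) * P.η + P.η) (R + (κ - P.ℓ) * P.η + P.η))) (z : ℂ) :
    H z - H (-z) = 0 := by
  have key : ∀ z, H z = P.phiProd 0 (m + 1) 0 (R + (κ - P.ℓ) * P.η) z *
      (P.th 0 0 (z + (lam + R + (κ + P.ℓ) * P.η)) *
        P.th 0 0 (z - (lam + R + (κ + P.ℓ) * P.η))) := by
    intro z
    have A2 := P.evenProd_shift_mul_left m (R + (κ - P.ℓ) * P.η) z
    have A3 := P.evenProd_succ m (R + (κ - P.ℓ) * P.η) z
    rw [show R + (κ - P.ℓ) * P.η + 2 * m * P.η = R + (κ' + P.ℓ) * P.η by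
      linear_combination P.η * (h1 + h2)] at A2 A3
    have t1 : P.th 0 0 (lam / 2 - z + P.ℓ * P.η + (R + lam / 2 + κ * P.η)) =
        P.th 0 0 (z - (lam + R + (κ + P.ℓ) * P.η)) := P.th_zero_zero_congr_neg (by ring)
    have t2 : P.th 0 0 (lam / 2 - z + P.ℓ * P.η - (R + lam / 2 + κ * P.η)) =
        P.th 0 0 (z + (R + (κ - P.ℓ) * P.η)) := P.th_zero_zero_congr_neg (by ring)
    have t3 : lam / 2 + z - P.ℓ * P.η + (R + lam / 2 + κ' * P.η) =
        z + (lam + R + (κ + P.ℓ) * P.η) := by linear_combination P.η * (h1 - h2)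
    have t4 : lam / 2 + z - P.ℓ * P.η - (R + lam / 2 + κ' * P.η) =
        z - (R + (κ' + P.ℓ) * P.η) := by ring
    rw [hH]
    unfold contraction phiProd
    rw [t1, t2, t3, t4, A3]
    simp only [evenProd, Finset.range_zero, Finset.prod_empty, one_mul] at A2 ⊢
    linear_combination P.th 0 0 (z - (R + (κ' + P.ℓ) * P.η)) *
      P.th 0 0 (z + (lam + R + (κ + P.ℓ) * P.η)) *
      P.th 0 0 (z - (lam + R + (κ + P.ℓ) * P.η)) * A2
  rw [key, key, phiProd_neg, sub_eq_zero, mul_comm (P.th 0 0 (z + _))]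
  congr 2 <;> exact P.th_zero_zero_congr_neg (by ring)

end Contraction

/-! ### Vertex-face correspondence for a single site -/

/-- The scalar prefactor `a_{k,k'}` of the intertwining vector. -/
noncomputable def phiCoef (k k' : ℤ) : ℂ :=
  cexp (2 * π * I * P.ℓ * (k + k') * P.η) * (-cexp (π * I * (sp - sm))) ^ (((k : ℂ) - k') / 2)

theorem phiCoef_down_down (k k' : ℤ) : P.phiCoef sp sm (k + -1) (k' + -1) =
    P.phiCoef sp sm k k' * cexp (-(4 * π * I * P.ℓ * P.η)) := by
  have e : cexp (2 * π * I * P.ℓ * ((k + -1 : ℤ) + (k' + -1 : ℤ)) * P.η) =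
      cexp (2 * π * I * P.ℓ * (k + k') * P.η) * cexp (-(4 * π * I * P.ℓ * P.η)) := by
    rw [← Complex.exp_add]; congr 1; push_cast; ring
  have c : ((k + -1 : ℤ) : ℂ) - (k' + -1 : ℤ) = k - k' := by push_cast; ring
  simp only [phiCoef, e, c]
  ring

theorem phiCoef_up_up (k k' : ℤ) : P.phiCoef sp sm (k + 1) (k' + 1) =
    P.phiCoef sp sm k k' * cexp (4 * π * I * P.ℓ * P.η) := by
  have e : cexp (2 * π * I * P.ℓ * ((k + 1 : ℤ) + (k' + 1 : ℤ)) * P.η) =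
      cexp (2 * π * I * P.ℓ * (k + k') * P.η) * cexp (4 * π * I * P.ℓ * P.η) := by
    rw [← Complex.exp_add]; congr 1; push_cast; ring
  have c : ((k + 1 : ℤ) : ℂ) - (k' + 1 : ℤ) = k - k' := by push_cast; ring
  simp only [phiCoef, e, c]
  ring

theorem phiCoef_up_down (k k' : ℤ) : P.phiCoef sp sm (k + 1) (k' + -1) =
    P.phiCoef sp sm k k' * -cexp (π * I * (sp - sm)) := by
  have hX : -cexp (π * I * (sp - sm)) ≠ 0 := neg_ne_zero.2 (Complex.exp_ne_zero _)
  have e : ((k + 1 : ℤ) : ℂ) + (k' + -1 : ℤ) = k + k' := by push_cast; ring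
  have c : (((k + 1 : ℤ) : ℂ) - (k' + -1 : ℤ)) / 2 = ((k : ℂ) - k') / 2 + 1 := by
    push_cast; ring
  simp only [phiCoef, e, c]
  rw [Complex.cpow_add _ _ hX, Complex.cpow_one, ← mul_assoc]

theorem phiCoef_down_up (k k' : ℤ) : P.phiCoef sp sm (k + -1) (k' + 1) =
    P.phiCoef sp sm k k' * -cexp (-(π * I * (sp - sm))) := by
  have hX : -cexp (π * I * (sp - sm)) ≠ 0 := neg_ne_zero.2 (Complex.exp_ne_zero _)
  have e : ((k + -1 : ℤ) : ℂ) + (k' + 1 : ℤ) = k + k' := by push_cast; ring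
  have c : (((k + -1 : ℤ) : ℂ) - (k' + 1 : ℤ)) / 2 = ((k : ℂ) - k') / 2 - 1 := by
    push_cast; ring
  simp only [phiCoef, e, c]
  rw [Complex.cpow_sub _ _ hX, Complex.cpow_one, Complex.exp_neg, div_neg, div_eq_mul_inv,
    mul_neg, mul_neg, ← mul_assoc]

theorem admissible_of_eq {d : ℤ} {n m : ℕ} (h : n + m = P.L) (hd : d = n - m) :
    P.Admissible d := ⟨n, by omega, by omega⟩

theorem two_mul_ℓ : 2 * P.ℓ = P.L := by unfold ℓ; ring

/-- The intertwining vector in terms of the numbers `n`, `m` of factors of the two kinds. -/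
theorem phi_apply {k k' : ℤ} {n m : ℕ} (h : n + m = P.L) (hd : k - k' = n - m) {A B : ℂ}
    (hA : A = sp / 2 + P.τ / 4 + (k' - P.ℓ) * P.η + P.η)
    (hB : B = sm / 2 + P.τ / 4 + (k - P.ℓ) * P.η + P.η) (z : ℂ) :
    (P.phi sp sm k k' 0).1 z = P.phiCoef sp sm k k' * P.phiProd n m A B z := by
  have e1 : ((P.L + (k - k')) / 2).toNat = n := by omega
  have e2 : ((P.L - (k - k')) / 2).toNat = m := by omega
  rw [phi, dif_pos (P.admissible_of_eq h hd)]
  change P.phiFun sp sm k k' 0 z = _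
  unfold phiFun phiCoef phiProd evenProd
  rw [e1, e2, mul_assoc, hA, hB]
  congr 2
  · refine Finset.prod_congr rfl fun j _ => ?_
    congr 2 <;> ring
  · refine Finset.prod_congr rfl fun j _ => ?_
    congr 2 <;> ring

theorem contraction_const_mul (lam v v' c : ℂ) (f : ℂ → ℂ) (z : ℂ) :
    P.contraction lam v v' (fun z => c * f z) z = c * P.contraction lam v v' f z := by
  unfold contraction; ring

theorem W_down_down (k k' : ℤ) (lam : ℂ) : P.W sp sm k k' (k + -1) (k' + -1) lam =
    2 * P.th 1 1 (lam + (k - k') * P.η) *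
      (P.th 1 1 (P.w sp sm ((k + k' + 2 * P.ℓ) / 2)) / P.th 1 1 (P.w sp sm k)) := by
  unfold W
  rw [if_pos ⟨by ring, by ring⟩]

theorem W_down_up (k k' : ℤ) (lam : ℂ) : P.W sp sm k k' (k + -1) (k' + 1) lam =
    2 * P.th 1 1 ((k' - k - 2 * P.ℓ) * P.η) *
      (P.th 1 1 (P.w sp sm ((k + k') / 2) + lam) /
        (P.th 1 1 (P.w sp sm k) * P.th 1 1 (P.w sp sm k'))) := by
  unfold W
  rw [if_neg (by omega), if_pos ⟨by ring, by ring⟩]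

theorem W_up_down (k k' : ℤ) (lam : ℂ) : P.W sp sm k k' (k + 1) (k' + -1) lam =
    2 * P.th 1 1 ((k - k' - 2 * P.ℓ) * P.η) * P.th 1 1 (P.w sp sm ((k + k') / 2) - lam) := by
  unfold W
  rw [if_neg (by omega), if_neg (by omega), if_pos ⟨by ring, by ring⟩]

theorem W_up_up (k k' : ℤ) (lam : ℂ) : P.W sp sm k k' (k + 1) (k' + 1) lam =
    2 * P.th 1 1 (lam - (k - k') * P.η) *
      (P.th 1 1 (P.w sp sm ((k + k' - 2 * P.ℓ) / 2)) / P.th 1 1 (P.w sp sm k')) := by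
  unfold W
  rw [if_neg (by omega), if_neg (by omega), if_neg (by omega), if_pos ⟨by ring, by ring⟩]

/-- The arguments `(s₊ + s₋)/2 + τ/2 + 2κη` produced by the addition formulas differ from `w_κ`
by `τ`. -/
theorem th_one_one_of_eq_w_add (κ y x : ℂ)
    (h : x = sp / 2 + P.τ / 4 + (sm / 2 + P.τ / 4) + 2 * κ * P.η + y) :
    P.th 1 1 x = -cexp (-(π * I * (2 * (P.w sp sm κ + y) + P.τ))) *
      P.th 1 1 (P.w sp sm κ + y) := by
  unfold th
  rw [← theta_one_one_add, h]
  congr 1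
  unfold w
  ring

/-- Two vectors in `ℂ²` agree if they have the same determinants with two independent vectors. -/
theorem eq_of_det_eq {u r b c : Fin 2 → ℂ} (hD : b 0 * c 1 - b 1 * c 0 ≠ 0)
    (hc : u 0 * c 1 - u 1 * c 0 = r 0 * c 1 - r 1 * c 0)
    (hb : u 0 * b 1 - u 1 * b 0 = r 0 * b 1 - r 1 * b 0) : u = r := by
  funext i
  refine mul_left_cancel₀ hD ?_
  fin_cases i
  · change _ * u 0 = _ * r 0
    linear_combination b 0 * hc - c 0 * hb
  · change _ * u 1 = _ * r 1
    linear_combination b 1 * hc - c 1 * hb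

/-- Elements of `V` may be compared after multiplication by `θ₁₁(2z)`. -/
theorem evenTheta_ext {f g : P.V} (h : ∀ z, P.th 1 1 (2 * z) * f.1 z = P.th 1 1 (2 * z) * g.1 z) :
    f = g := by
  refine P.mulEquiv.injective (Subtype.ext (funext fun z => ?_))
  exact h z

/-- The vector argument of the first column of the gauge transformation. -/
noncomputable def argX (k : ℤ) (lam : ℂ) : ℂ := sp / 2 + P.τ / 4 - lam / 2 + k * P.η

/-- The vector argument of the second column of the gauge transformation. -/
noncomputable def argY (k : ℤ) (lam : ℂ) : ℂ := sm / 2 + P.τ / 4 + lam / 2 + k * P.η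

theorem gauge_zero (k : ℤ) (lam : ℂ) (i : Fin 2) : P.gauge sp sm k lam i 0 =
    P.gaugeConst * cexp (π * I * (sp - lam + 2 * k * P.η)) *
      halfVec P.τ (P.argX sp k lam) i := by
  rw [gauge_apply, argX]
  simp only [Matrix.cons_val_zero]
  congr 2; ring

theorem gauge_one (k : ℤ) (lam : ℂ) (i : Fin 2) : P.gauge sp sm k lam i 1 =
    P.gaugeConst * cexp (π * I * (sm + lam + 2 * k * P.η)) *
      halfVec P.τ (P.argY sm k lam) i * (P.th 1 1 (P.w sp sm k))⁻¹ := by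
  rw [gauge_apply, argY]
  simp only [Matrix.cons_val_one, Matrix.cons_val_fin_one]
  congr 3; ring

theorem halfVec_det_ne_zero {k : ℤ} {lam : ℂ} (hdet : (P.gauge sp sm k lam).det ≠ 0) :
    halfVec P.τ (P.argX sp k lam) 0 * halfVec P.τ (P.argY sm k lam) 1 -
      halfVec P.τ (P.argX sp k lam) 1 * halfVec P.τ (P.argY sm k lam) 0 ≠ 0 := by
  intro h
  refine hdet ?_
  rw [Matrix.det_fin_two, gauge_zero, gauge_zero, gauge_one, gauge_one]
  linear_combination P.gaugeConst * cexp (π * I * (sp - lam + 2 * k * P.η)) *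
    P.gaugeConst * cexp (π * I * (sm + lam + 2 * k * P.η)) * (P.th 1 1 (P.w sp sm k))⁻¹ * h

/-! ### Scalar factors of the face weights

The constants in the odd parts of the contractions agree with the face weights, once the
quasi-periodicity factors of `θ₁₁` are matched with the exponential factors of the gauge vectors and
of the intertwining vectors.
-/

section Scalars

variable (k k' : ℤ) (lam : ℂ)

theorem scalar_down_down (hk : P.th 1 1 (P.w sp sm k) ≠ 0) :
    cexp (π * I * (sp - lam + 2 * k' * P.η)) * 4 *
      (P.th 1 1 (sp / 2 + P.τ / 4 + (sm / 2 + P.τ / 4) + (k + k' + 2 * P.ℓ) * P.η) *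
        P.th 1 1 (sp / 2 + P.τ / 4 - (sm / 2 + P.τ / 4) - lam) *
        P.th 1 1 (lam + (k - k') * P.η)) =
    cexp (π * I * (sp - lam + 2 * k * P.η)) * P.W sp sm k k' (k + -1) (k' + -1) lam *
      cexp (-(4 * π * I * P.ℓ * P.η)) *
      (2 * (P.th 1 1 (P.argX sp k lam + P.argY sm k lam) *
        P.th 1 1 (P.argX sp k lam - P.argY sm k lam))) := by
  rw [W_down_down, P.th_one_one_of_eq_w_add sp sm ((k + k' + 2 * P.ℓ) / 2) 0 (sp / 2 + P.τ / 4 +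
      (sm / 2 + P.τ / 4) + (k + k' + 2 * P.ℓ) * P.η) (by ring),
    P.th_one_one_of_eq_w_add sp sm k 0 (P.argX sp k lam + P.argY sm k lam)
      (by unfold argX argY; ring), add_zero, add_zero,
    show P.argX sp k lam - P.argY sm k lam = sp / 2 + P.τ / 4 - (sm / 2 + P.τ / 4) - lam by
      unfold argX argY; ring]
  have hexp : cexp (π * I * (sp - lam + 2 * k' * P.η)) *
      cexp (-(π * I * (2 * P.w sp sm ((k + k' + 2 * P.ℓ) / 2) + P.τ))) =
      cexp (π * I * (sp - lam + 2 * k * P.η)) * cexp (-(4 * π * I * P.ℓ * P.η)) *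
        cexp (-(π * I * (2 * P.w sp sm k + P.τ))) := by
    rw [← Complex.exp_add, ← Complex.exp_add, ← Complex.exp_add]
    congr 1; unfold w; ring
  have alg : ∀ {e₁ E₁ e₂ e₃ E₂ T U V K : ℂ}, K ≠ 0 → e₁ * E₁ = e₂ * e₃ * E₂ →
      e₁ * 4 * (-E₁ * T * U * V) = e₂ * (2 * V * (T / K)) * e₃ * (2 * (-E₂ * K * U)) := by
    intro e₁ E₁ e₂ e₃ E₂ T U V K hK h
    field_simp
    linear_combination -4 * T * U * V * h
  exact alg hk hexp

theorem scalar_up_down (hk : P.th 1 1 (P.w sp sm k) ≠ 0) :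
    cexp (π * I * (sp - lam + 2 * k' * P.η)) * 4 *
      (P.th 1 1 (-((k - k' - 2 * P.ℓ) * P.η)) *
        P.th 1 1 (sp / 2 + P.τ / 4 + (sm / 2 + P.τ / 4) + (k + k') * P.η - lam) *
        P.th 1 1 (sm / 2 + P.τ / 4 - (sp / 2 + P.τ / 4) + lam)) =
    cexp (π * I * (sm + lam + 2 * k * P.η)) * (P.th 1 1 (P.w sp sm k))⁻¹ *
      P.W sp sm k k' (k + 1) (k' + -1) lam * (-cexp (π * I * (sp - sm))) *
      (2 * (P.th 1 1 (P.argY sm k lam + P.argX sp k lam) *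
        P.th 1 1 (P.argY sm k lam - P.argX sp k lam))) := by
  rw [W_up_down, th_one_one_neg,
    P.th_one_one_of_eq_w_add sp sm ((k + k') / 2) (-lam) (sp / 2 + P.τ / 4 +
      (sm / 2 + P.τ / 4) + (k + k') * P.η - lam) (by ring),
    P.th_one_one_of_eq_w_add sp sm k 0 (P.argY sm k lam + P.argX sp k lam)
      (by unfold argX argY; ring), add_zero, ← sub_eq_add_neg,
    show P.argY sm k lam - P.argX sp k lam = sm / 2 + P.τ / 4 - (sp / 2 + P.τ / 4) + lam by
      unfold argX argY; ring]
  have hexp : cexp (π * I * (sp - lam + 2 * k' * P.η)) *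
      cexp (-(π * I * (2 * (P.w sp sm ((k + k') / 2) - lam) + P.τ))) =
      cexp (π * I * (sm + lam + 2 * k * P.η)) * cexp (π * I * (sp - sm)) *
        cexp (-(π * I * (2 * P.w sp sm k + P.τ))) := by
    rw [← Complex.exp_add, ← Complex.exp_add, ← Complex.exp_add]
    congr 1; unfold w; ring
  have alg : ∀ {e₁ E₁ e₂ e₃ E₂ T U V K : ℂ}, K ≠ 0 → e₁ * E₁ = e₂ * e₃ * E₂ →
      e₁ * 4 * (-T * (-E₁ * U) * V) = e₂ * K⁻¹ * (2 * T * U) * -e₃ * (2 * (-E₂ * K * V)) := by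
    intro e₁ E₁ e₂ e₃ E₂ T U V K hK h
    field_simp
    linear_combination 4 * T * U * V * h
  exact alg hk hexp

theorem scalar_up_up (hk : P.th 1 1 (P.w sp sm k) ≠ 0) (hk' : P.th 1 1 (P.w sp sm k') ≠ 0) :
    cexp (π * I * (sm + lam + 2 * k' * P.η)) * (P.th 1 1 (P.w sp sm k'))⁻¹ * 4 *
      (P.th 1 1 (-(sp / 2 + P.τ / 4 + (sm / 2 + P.τ / 4) + (k + k' - 2 * P.ℓ) * P.η)) *
        P.th 1 1 (-(lam - (k - k') * P.η)) *
        P.th 1 1 (sm / 2 + P.τ / 4 - (sp / 2 + P.τ / 4) + lam)) =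
    cexp (π * I * (sm + lam + 2 * k * P.η)) * (P.th 1 1 (P.w sp sm k))⁻¹ *
      P.W sp sm k k' (k + 1) (k' + 1) lam * cexp (4 * π * I * P.ℓ * P.η) *
      (2 * (P.th 1 1 (P.argY sm k lam + P.argX sp k lam) *
        P.th 1 1 (P.argY sm k lam - P.argX sp k lam))) := by
  rw [W_up_up, th_one_one_neg, th_one_one_neg,
    P.th_one_one_of_eq_w_add sp sm ((k + k' - 2 * P.ℓ) / 2) 0 (sp / 2 + P.τ / 4 +
      (sm / 2 + P.τ / 4) + (k + k' - 2 * P.ℓ) * P.η) (by ring),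
    P.th_one_one_of_eq_w_add sp sm k 0 (P.argY sm k lam + P.argX sp k lam)
      (by unfold argX argY; ring), add_zero, add_zero,
    show P.argY sm k lam - P.argX sp k lam = sm / 2 + P.τ / 4 - (sp / 2 + P.τ / 4) + lam by
      unfold argX argY; ring]
  have hexp : cexp (π * I * (sm + lam + 2 * k' * P.η)) *
      cexp (-(π * I * (2 * P.w sp sm ((k + k' - 2 * P.ℓ) / 2) + P.τ))) =
      cexp (π * I * (sm + lam + 2 * k * P.η)) * cexp (4 * π * I * P.ℓ * P.η) *
        cexp (-(π * I * (2 * P.w sp sm k + P.τ))) := by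
    rw [← Complex.exp_add, ← Complex.exp_add, ← Complex.exp_add]
    congr 1; unfold w; ring
  have alg : ∀ {e₁ E₁ e₂ e₃ E₂ T U V K K' : ℂ}, K ≠ 0 → K' ≠ 0 → e₁ * E₁ = e₂ * e₃ * E₂ →
      e₁ * K'⁻¹ * 4 * (-(-E₁ * T) * -U * V) =
        e₂ * K⁻¹ * (2 * U * (T / K')) * e₃ * (2 * (-E₂ * K * V)) := by
    intro e₁ E₁ e₂ e₃ E₂ T U V K K' hK hK' h
    field_simp
    linear_combination -4 * T * U * V * h
  exact alg hk hk' hexp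

theorem scalar_down_up (hk : P.th 1 1 (P.w sp sm k) ≠ 0) (hk' : P.th 1 1 (P.w sp sm k') ≠ 0) :
    cexp (π * I * (sm + lam + 2 * k' * P.η)) * (P.th 1 1 (P.w sp sm k'))⁻¹ * 4 *
      (P.th 1 1 (-((k' - k - 2 * P.ℓ) * P.η)) *
        P.th 1 1 (sp / 2 + P.τ / 4 - (sm / 2 + P.τ / 4) - lam) *
        P.th 1 1 (sp / 2 + P.τ / 4 + (sm / 2 + P.τ / 4) + (k + k') * P.η + lam)) =
    cexp (π * I * (sp - lam + 2 * k * P.η)) * P.W sp sm k k' (k + -1) (k' + 1) lam *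
      (-cexp (-(π * I * (sp - sm)))) *
      (2 * (P.th 1 1 (P.argX sp k lam + P.argY sm k lam) *
        P.th 1 1 (P.argX sp k lam - P.argY sm k lam))) := by
  rw [W_down_up, th_one_one_neg,
    P.th_one_one_of_eq_w_add sp sm ((k + k') / 2) lam (sp / 2 + P.τ / 4 +
      (sm / 2 + P.τ / 4) + (k + k') * P.η + lam) (by ring),
    P.th_one_one_of_eq_w_add sp sm k 0 (P.argX sp k lam + P.argY sm k lam)
      (by unfold argX argY; ring), add_zero,
    show P.argX sp k lam - P.argY sm k lam = sp / 2 + P.τ / 4 - (sm / 2 + P.τ / 4) - lam by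
      unfold argX argY; ring]
  have hexp : cexp (π * I * (sm + lam + 2 * k' * P.η)) *
      cexp (-(π * I * (2 * (P.w sp sm ((k + k') / 2) + lam) + P.τ))) =
      cexp (π * I * (sp - lam + 2 * k * P.η)) * cexp (-(π * I * (sp - sm))) *
        cexp (-(π * I * (2 * P.w sp sm k + P.τ))) := by
    rw [← Complex.exp_add, ← Complex.exp_add, ← Complex.exp_add]
    congr 1; unfold w; ring
  have alg : ∀ {e₁ E₁ e₂ e₃ E₂ T U V K K' : ℂ}, K ≠ 0 → K' ≠ 0 → e₁ * E₁ = e₂ * e₃ * E₂ →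
      e₁ * K'⁻¹ * 4 * (-T * U * (-E₁ * V)) =
        e₂ * (2 * T * (V / (K * K'))) * -e₃ * (2 * (-E₂ * K * U)) := by
    intro e₁ E₁ e₂ e₃ E₂ T U V K K' hK hK' h
    field_simp
    linear_combination 4 * T * U * V * h
  exact alg hk hk' hexp

end Scalars

/-! ### The action of the `L` operator on intertwining vectors -/

theorem th_one_one_zero : P.th 1 1 0 = 0 := by
  have h := P.th_one_one_neg 0
  rw [neg_zero] at h
  linear_combination h / 2

theorem contraction_phi {k k' : ℤ} {n m : ℕ} (h : n + m = P.L) (hd : k - k' = n - m)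
    (lam v v' z : ℂ) :
    P.contraction lam v v' (P.phi sp sm k k' 0).1 z = P.phiCoef sp sm k k' *
      P.contraction lam v v' (P.phiProd n m (sp / 2 + P.τ / 4 + (k' - P.ℓ) * P.η + P.η)
        (sm / 2 + P.τ / 4 + (k - P.ℓ) * P.η + P.η)) z := by
  rw [← contraction_const_mul]
  congr 1
  funext z
  exact P.phi_apply sp sm h hd rfl rfl z

/-- The `L` operator applied to an intertwining vector and the first gauge vector. -/
theorem locL_gauge_zero {k k' : ℤ} {n m : ℕ} (h : n + m = P.L) (hd : k - k' = n - m) {lam : ℂ}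
    (hk : P.th 1 1 (P.w sp sm k) ≠ 0) (hdet : (P.gauge sp sm k lam).det ≠ 0) (i : Fin 2) :
    P.gauge sp sm k' lam 0 0 • P.locL lam i 0 (P.phi sp sm k k' 0) +
        P.gauge sp sm k' lam 1 0 • P.locL lam i 1 (P.phi sp sm k k' 0) =
      P.gauge sp sm k lam i 0 • P.W sp sm k k' (k + -1) (k' + -1) lam •
          P.phi sp sm (k + -1) (k' + -1) 0 +
        P.gauge sp sm k lam i 1 • P.W sp sm k k' (k + 1) (k' + -1) lam •
          P.phi sp sm (k + 1) (k' + -1) 0 := by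
  have h1 : (n : ℂ) + m = 2 * P.ℓ := by rw [two_mul_ℓ]; exact_mod_cast h
  have h2 : (k : ℂ) - k' = n - m := by exact_mod_cast hd
  refine P.evenTheta_ext fun z => ?_
  change P.th 1 1 (2 * z) * (_ * (P.locL lam i 0 (P.phi sp sm k k' 0)).1 z +
      _ * (P.locL lam i 1 (P.phi sp sm k k' 0)).1 z) =
    P.th 1 1 (2 * z) * (_ * (_ * (P.phi sp sm (k + -1) (k' + -1) 0).1 z) +
      _ * (_ * (P.phi sp sm (k + 1) (k' + -1) 0).1 z))
  -- Compare the determinants with the two gauge vectors attached to `k`.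
  revert i
  refine congrFun (eq_of_det_eq (P.halfVec_det_ne_zero sp sm hdet) ?_ ?_)
  · have hc := P.locL_contraction lam (P.argY sm k lam) (P.argX sp k' lam)
      (P.phi sp sm k k' 0) z
    have hH := P.contraction_down_down (S := sp / 2 + P.τ / 4) (R := sm / 2 + P.τ / 4)
      (lam := lam) h1 h2 rfl z
    have hs := P.scalar_down_down sp sm k k' lam hk
    have hD := halfVec_det (P.argX sp k lam) (P.argY sm k lam) P.τ_im
    have hφ := P.phi_apply sp sm (k := k + -1) (k' := k' + -1) h (by omega)
      (A := sp / 2 + P.τ / 4 + (k' - P.ℓ) * P.η) (B := sm / 2 + P.τ / 4 + (k - P.ℓ) * P.η)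
      (by push_cast; ring) (by push_cast; ring) z
    rw [P.contraction_phi sp sm h hd, P.contraction_phi sp sm h hd, ← mul_sub] at hc
    rw [phiCoef_down_down] at hφ
    simp only [gauge_zero, gauge_one, hφ]
    change _ = 2 * (P.th 1 1 _ * P.th 1 1 _) at hD
    rw [← hD] at hs
    unfold argX argY at *
    linear_combination P.gaugeConst * cexp (π * I * (sp - lam + 2 * k' * P.η)) * hc +
      P.gaugeConst * cexp (π * I * (sp - lam + 2 * k' * P.η)) * 4 * P.phiCoef sp sm k k' * hH +
      P.gaugeConst * P.phiCoef sp sm k k' * P.th 1 1 (2 * z) *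
        P.phiProd n m (sp / 2 + P.τ / 4 + (k' - P.ℓ) * P.η)
          (sm / 2 + P.τ / 4 + (k - P.ℓ) * P.η) z * hs
  · have hc := P.locL_contraction lam (P.argX sp k lam) (P.argX sp k' lam)
      (P.phi sp sm k k' 0) z
    rw [P.contraction_phi sp sm h hd, P.contraction_phi sp sm h hd, ← mul_sub] at hc
    simp only [gauge_zero, gauge_one]
    unfold argX argY at *
    rcases m with _ | m
    · -- Here `k - k' = 2ℓ`: the face weight contains the factor `θ₁₁(0)`.
      have hW : P.W sp sm k k' (k + 1) (k' + -1) lam = 0 := by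
        rw [W_up_down, show ((k : ℂ) - k' - 2 * P.ℓ) * P.η = 0 by rw [h2, ← h1]; simp,
          th_one_one_zero]
        ring
      have hH := P.contraction_up_down_zero (S := sp / 2 + P.τ / 4) (R := sm / 2 + P.τ / 4)
        (lam := lam) (κ := k) (κ' := k') (n := n) (by simpa using h1) (by simpa using h2) rfl z
      rw [hW]
      linear_combination P.gaugeConst * cexp (π * I * (sp - lam + 2 * k' * P.η)) * hc +
        P.gaugeConst * cexp (π * I * (sp - lam + 2 * k' * P.η)) * 4 * P.phiCoef sp sm k k' * hH
    · have hH := P.contraction_up_down (S := sp / 2 + P.τ / 4) (R := sm / 2 + P.τ / 4)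
        (lam := lam) h1 h2 rfl z
      have hs := P.scalar_up_down sp sm k k' lam hk
      have hD := halfVec_det (P.argY sm k lam) (P.argX sp k lam) P.τ_im
      have hφ := P.phi_apply sp sm (k := k + 1) (k' := k' + -1) (n := n + 1) (m := m) (by omega)
        (by push_cast at hd ⊢; omega)
        (A := sp / 2 + P.τ / 4 + (k' - P.ℓ) * P.η)
        (B := sm / 2 + P.τ / 4 + (k - P.ℓ) * P.η + 2 * P.η)
        (by push_cast; ring) (by push_cast; ring) z
      rw [phiCoef_up_down] at hφ
      change _ = 2 * (P.th 1 1 _ * P.th 1 1 _) at hD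
      rw [← hD] at hs
      unfold argX argY at hs
      rw [hφ]
      linear_combination P.gaugeConst * cexp (π * I * (sp - lam + 2 * k' * P.η)) * hc +
        P.gaugeConst * cexp (π * I * (sp - lam + 2 * k' * P.η)) * 4 * P.phiCoef sp sm k k' * hH +
        P.gaugeConst * P.phiCoef sp sm k k' * P.th 1 1 (2 * z) *
          P.phiProd (n + 1) m (sp / 2 + P.τ / 4 + (k' - P.ℓ) * P.η)
            (sm / 2 + P.τ / 4 + (k - P.ℓ) * P.η + 2 * P.η) z * hs

/-- The `L` operator applied to an intertwining vector and the second gauge vector. -/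
theorem locL_gauge_one {k k' : ℤ} {n m : ℕ} (h : n + m = P.L) (hd : k - k' = n - m) {lam : ℂ}
    (hk : P.th 1 1 (P.w sp sm k) ≠ 0) (hk' : P.th 1 1 (P.w sp sm k') ≠ 0)
    (hdet : (P.gauge sp sm k lam).det ≠ 0) (i : Fin 2) :
    P.gauge sp sm k' lam 0 1 • P.locL lam i 0 (P.phi sp sm k k' 0) +
        P.gauge sp sm k' lam 1 1 • P.locL lam i 1 (P.phi sp sm k k' 0) =
      P.gauge sp sm k lam i 0 • P.W sp sm k k' (k + -1) (k' + 1) lam •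
          P.phi sp sm (k + -1) (k' + 1) 0 +
        P.gauge sp sm k lam i 1 • P.W sp sm k k' (k + 1) (k' + 1) lam •
          P.phi sp sm (k + 1) (k' + 1) 0 := by
  have h1 : (n : ℂ) + m = 2 * P.ℓ := by rw [two_mul_ℓ]; exact_mod_cast h
  have h2 : (k : ℂ) - k' = n - m := by exact_mod_cast hd
  refine P.evenTheta_ext fun z => ?_
  change P.th 1 1 (2 * z) * (_ * (P.locL lam i 0 (P.phi sp sm k k' 0)).1 z +
      _ * (P.locL lam i 1 (P.phi sp sm k k' 0)).1 z) =
    P.th 1 1 (2 * z) * (_ * (_ * (P.phi sp sm (k + -1) (k' + 1) 0).1 z) +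
      _ * (_ * (P.phi sp sm (k + 1) (k' + 1) 0).1 z))
  -- Compare the determinants with the two gauge vectors attached to `k`.
  revert i
  refine congrFun (eq_of_det_eq (P.halfVec_det_ne_zero sp sm hdet) ?_ ?_)
  · have hc := P.locL_contraction lam (P.argY sm k lam) (P.argY sm k' lam)
      (P.phi sp sm k k' 0) z
    rw [P.contraction_phi sp sm h hd, P.contraction_phi sp sm h hd, ← mul_sub] at hc
    simp only [gauge_one, gauge_zero]
    unfold argX argY at *
    rcases n with _ | n
    · -- Here `k - k' = -2ℓ`: the face weight contains the factor `θ₁₁(0)`.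
      have hW : P.W sp sm k k' (k + -1) (k' + 1) lam = 0 := by
        rw [W_down_up, show ((k' : ℂ) - k - 2 * P.ℓ) * P.η = 0 by
          rw [← h1]; push_cast at h2 ⊢; linear_combination -P.η * h2, th_one_one_zero]
        ring
      have hH := P.contraction_down_up_zero (S := sp / 2 + P.τ / 4) (R := sm / 2 + P.τ / 4)
        (lam := lam) (κ := k) (κ' := k') (m := m) (by simpa using h1) (by simpa using h2) rfl z
      rw [hW]
      linear_combination P.gaugeConst * cexp (π * I * (sm + lam + 2 * k' * P.η)) *
          (P.th 1 1 (P.w sp sm k'))⁻¹ * hc +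
        P.gaugeConst * cexp (π * I * (sm + lam + 2 * k' * P.η)) *
          (P.th 1 1 (P.w sp sm k'))⁻¹ * 4 * P.phiCoef sp sm k k' * hH
    · have hH := P.contraction_down_up (S := sp / 2 + P.τ / 4) (R := sm / 2 + P.τ / 4)
        (lam := lam) h1 h2 rfl z
      have hs := P.scalar_down_up sp sm k k' lam hk hk'
      have hD := halfVec_det (P.argX sp k lam) (P.argY sm k lam) P.τ_im
      have hφ := P.phi_apply sp sm (k := k + -1) (k' := k' + 1) (n := n) (m := m + 1) (by omega)
        (by push_cast at hd ⊢; omega)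
        (A := sp / 2 + P.τ / 4 + (k' - P.ℓ) * P.η + 2 * P.η)
        (B := sm / 2 + P.τ / 4 + (k - P.ℓ) * P.η)
        (by push_cast; ring) (by push_cast; ring) z
      rw [phiCoef_down_up] at hφ
      change _ = 2 * (P.th 1 1 _ * P.th 1 1 _) at hD
      rw [← hD] at hs
      unfold argX argY at hs
      rw [hφ]
      linear_combination P.gaugeConst * cexp (π * I * (sm + lam + 2 * k' * P.η)) *
          (P.th 1 1 (P.w sp sm k'))⁻¹ * hc +
        P.gaugeConst * cexp (π * I * (sm + lam + 2 * k' * P.η)) *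
          (P.th 1 1 (P.w sp sm k'))⁻¹ * 4 * P.phiCoef sp sm k k' * hH +
        P.gaugeConst * P.phiCoef sp sm k k' * P.th 1 1 (2 * z) *
          P.phiProd n (m + 1) (sp / 2 + P.τ / 4 + (k' - P.ℓ) * P.η + 2 * P.η)
            (sm / 2 + P.τ / 4 + (k - P.ℓ) * P.η) z * hs
  · have hc := P.locL_contraction lam (P.argX sp k lam) (P.argY sm k' lam)
      (P.phi sp sm k k' 0) z
    have hH := P.contraction_up_up (S := sp / 2 + P.τ / 4) (R := sm / 2 + P.τ / 4)
      (lam := lam) h1 h2 rfl z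
    have hs := P.scalar_up_up sp sm k k' lam hk hk'
    have hD := halfVec_det (P.argY sm k lam) (P.argX sp k lam) P.τ_im
    have hφ := P.phi_apply sp sm (k := k + 1) (k' := k' + 1) h (by omega)
      (A := sp / 2 + P.τ / 4 + (k' - P.ℓ) * P.η + 2 * P.η)
      (B := sm / 2 + P.τ / 4 + (k - P.ℓ) * P.η + 2 * P.η)
      (by push_cast; ring) (by push_cast; ring) z
    rw [P.contraction_phi sp sm h hd, P.contraction_phi sp sm h hd, ← mul_sub] at hc
    rw [phiCoef_up_up] at hφ
    simp only [gauge_zero, gauge_one, hφ]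
    change _ = 2 * (P.th 1 1 _ * P.th 1 1 _) at hD
    rw [← hD] at hs
    unfold argX argY at *
    linear_combination P.gaugeConst * cexp (π * I * (sm + lam + 2 * k' * P.η)) *
        (P.th 1 1 (P.w sp sm k'))⁻¹ * hc +
      P.gaugeConst * cexp (π * I * (sm + lam + 2 * k' * P.η)) *
        (P.th 1 1 (P.w sp sm k'))⁻¹ * 4 * P.phiCoef sp sm k k' * hH +
      P.gaugeConst * P.phiCoef sp sm k k' * P.th 1 1 (2 * z) *
        P.phiProd n m (sp / 2 + P.τ / 4 + (k' - P.ℓ) * P.η + 2 * P.η)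
          (sm / 2 + P.τ / 4 + (k - P.ℓ) * P.η + 2 * P.η) z * hs

/-- The two height steps: the gauge vectors with index `0` and `1` lower and raise the heights. -/
def step : Fin 2 → ℤ := ![-1, 1]

/-- The vertex-face correspondence: conjugation of the `L` operator by the gauge transformations
turns its action on intertwining vectors into the face weights. -/
theorem locL_gauge {k k' : ℤ} (h : P.Admissible (k - k')) {lam : ℂ}
    (hk : P.th 1 1 (P.w sp sm k) ≠ 0) (hk' : P.th 1 1 (P.w sp sm k') ≠ 0)
    (hdet : (P.gauge sp sm k lam).det ≠ 0) (i j : Fin 2) :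
    ∑ q, P.gauge sp sm k' lam q j • P.locL lam i q (P.phi sp sm k k' 0) =
      ∑ q, P.gauge sp sm k lam i q • P.W sp sm k k' (k + step q) (k' + step j) lam •
        P.phi sp sm (k + step q) (k' + step j) 0 := by
  obtain ⟨n, hn, hd⟩ := h
  have h1 : n + (P.L - n) = P.L := by omega
  have h2 : k - k' = (n : ℤ) - ((P.L - n : ℕ) : ℤ) := by omega
  rw [Fin.sum_univ_two, Fin.sum_univ_two]
  fin_cases j
  · exact P.locL_gauge_zero sp sm h1 h2 hk hdet i
  · exact P.locL_gauge_one sp sm h1 h2 hk hk' hdet i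

end Model

/-! ### Path sums of multilinear maps -/

section PathSum

variable {V H : Type*} [AddCommMonoid V] [Module ℂ V] [AddCommMonoid H] [Module ℂ H]

/-- The entry `(e, j)` of the ordered product `X_{K-1} ⋯ X_1 X_0` of `2 × 2` matrices with entries
in `V`, where products of vectors are formed with the multilinear map `Φ`: a sum over index
paths from `j` to `e`. -/
def pathSum {K : ℕ} (Φ : MultilinearMap ℂ (fun _ : Fin K => V) H)
    (X : Fin K → Fin 2 → Fin 2 → V) (e j : Fin 2) : H :=
  ∑ ε : Fin (K + 1) → Fin 2, if ε (Fin.last K) = e ∧ ε 0 = j then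
    Φ fun n => X n (ε n.succ) (ε n.castSucc) else 0

theorem pathSum_zero (Φ : MultilinearMap ℂ (fun _ : Fin 0 => V) H)
    (X : Fin 0 → Fin 2 → Fin 2 → V) (e j : Fin 2) :
    pathSum Φ X e j = if e = j then Φ 0 else 0 := by
  unfold pathSum
  rw [← (Equiv.funUnique (Fin 1) (Fin 2)).symm.sum_comp]
  have h : ∀ x : Fin 2, (if (Equiv.funUnique (Fin 1) (Fin 2)).symm x (Fin.last 0) = e ∧
      (Equiv.funUnique (Fin 1) (Fin 2)).symm x 0 = j then
      Φ fun n => X n ((Equiv.funUnique (Fin 1) (Fin 2)).symm x n.succ)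
        ((Equiv.funUnique (Fin 1) (Fin 2)).symm x n.castSucc) else 0) =
      if x = e then (if e = j then Φ 0 else 0) else 0 := by
    intro x
    have h0 : (fun n : Fin 0 => X n ((Equiv.funUnique (Fin 1) (Fin 2)).symm x n.succ)
        ((Equiv.funUnique (Fin 1) (Fin 2)).symm x n.castSucc)) = 0 := Subsingleton.elim _ _
    rw [h0]
    change (if x = e ∧ x = j then Φ 0 else 0) = _
    by_cases hx : x = e <;> simp [hx]
  simp only [h, Finset.sum_ite_eq', Finset.mem_univ, if_true]

theorem pathSum_succ {K : ℕ} (Φ : MultilinearMap ℂ (fun _ : Fin (K + 1) => V) H)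
    (X : Fin (K + 1) → Fin 2 → Fin 2 → V) (e j : Fin 2) :
    pathSum Φ X e j = ∑ m, pathSum (Φ.curryLeft (X 0 m j)) (fun n => X n.succ) e m := by
  unfold pathSum
  rw [Finset.sum_comm, ← (Fin.consEquiv fun _ : Fin (K + 2) => Fin 2).sum_comp,
    Fintype.sum_prod_type, Finset.sum_comm]
  refine Finset.sum_congr rfl fun ε _ => ?_
  rw [Finset.sum_eq_single j, Finset.sum_eq_single (ε 0)]
  · rw [MultilinearMap.curryLeft_apply]
    have hl : (Fin.consEquiv fun _ : Fin (K + 2) => Fin 2) (j, ε) (Fin.last (K + 1)) =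
        ε (Fin.last K) := rfl
    have h0 : (Fin.consEquiv fun _ : Fin (K + 2) => Fin 2) (j, ε) 0 = j := rfl
    rw [hl, h0]
    simp only [and_true]
    congr 2
    funext n
    refine Fin.cases ?_ (fun n => ?_) n
    · rfl
    · rfl
  · intro m _ hm
    rw [if_neg]
    exact fun h => hm h.2.symm
  · simp
  · intro m _ hm
    rw [if_neg]
    exact fun h => hm h.2
  · simp

theorem pathSum_sum_smul {K : ℕ} (c : Fin 2 → ℂ)
    (Φ : Fin 2 → MultilinearMap ℂ (fun _ : Fin K => V) H)
    (X : Fin K → Fin 2 → Fin 2 → V) (e j : Fin 2) :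
    pathSum (∑ q, c q • Φ q) X e j = ∑ q, c q • pathSum (Φ q) X e j := by
  unfold pathSum
  simp only [Finset.smul_sum]
  rw [Finset.sum_comm]
  refine Finset.sum_congr rfl fun ε _ => ?_
  split_ifs
  · simp
  · simp

/-- Gauge transformations between consecutive matrices telescope in a path sum. -/
theorem pathSum_gauge {K : ℕ} (G : Fin (K + 1) → Matrix (Fin 2) (Fin 2) ℂ)
    (Y X : Fin K → Fin 2 → Fin 2 → V)
    (h : ∀ n i j, ∑ q, G n.castSucc q j • Y n i q = ∑ q, G n.succ i q • X n q j)
    (Φ : MultilinearMap ℂ (fun _ : Fin K => V) H) (i j : Fin 2) :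
    ∑ q, G 0 q j • pathSum Φ Y i q = ∑ q, G (Fin.last K) i q • pathSum Φ X q j := by
  induction K generalizing j with
  | zero =>
    simp only [pathSum_zero]
    simp
  | succ K ih =>
    have h0 : ∀ p, ∑ q, G 0 q j • Φ.curryLeft (Y 0 p q) =
        ∑ q, G (Fin.succ 0) p q • Φ.curryLeft (X 0 q j) := by
      intro p
      have := congrArg Φ.curryLeft (h 0 p j)
      simpa only [map_sum, map_smul, Fin.castSucc_zero] using this
    calc ∑ q, G 0 q j • pathSum Φ Y i q
        = ∑ p, pathSum (∑ q, G 0 q j • Φ.curryLeft (Y 0 p q)) (fun n => Y n.succ) i p := by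
          simp only [pathSum_succ Φ, pathSum_sum_smul, Finset.smul_sum]
          exact Finset.sum_comm
      _ = ∑ q, ∑ p, G (Fin.succ 0) p q •
            pathSum (Φ.curryLeft (X 0 q j)) (fun n => Y n.succ) i p := by
          simp only [h0, pathSum_sum_smul]
          exact Finset.sum_comm
      _ = ∑ q, ∑ p, G (Fin.last (K + 1)) i p •
            pathSum (Φ.curryLeft (X 0 q j)) (fun n => X n.succ) p q := by
          refine Finset.sum_congr rfl fun q _ => ?_
          exact ih (fun n => G n.succ) (fun n => Y n.succ) (fun n => X n.succ)
            (fun n => h n.succ) (Φ.curryLeft (X 0 q j)) q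
      _ = ∑ q, G (Fin.last (K + 1)) i q • pathSum Φ X q j := by
          simp only [pathSum_succ Φ, Finset.smul_sum]
          exact Finset.sum_comm

/-- An ordered product of matrices of operators, each acting on a single argument of `Φ`. -/
theorem prod_apply_eq_pathSum {K : ℕ} (Φ : MultilinearMap ℂ (fun _ : Fin K => V) H)
    (S : Fin K → Matrix (Fin 2) (Fin 2) (Module.End ℂ H))
    (A : Fin K → Fin 2 → Fin 2 → Module.End ℂ V)
    (hS : ∀ n a b v, S n a b (Φ v) = Φ (Function.update v n (A n a b (v n))))
    (v : Fin K → V) (e j : Fin 2) :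
    (List.ofFn S).reverse.prod e j (Φ v) = pathSum Φ (fun n a b => A n a b (v n)) e j := by
  induction K generalizing j with
  | zero =>
    rw [pathSum_zero, List.ofFn_zero, List.reverse_nil, List.prod_nil, Matrix.one_apply,
      Subsingleton.elim v 0]
    split_ifs <;> simp
  | succ K ih =>
    rw [pathSum_succ, List.ofFn_succ, List.reverse_cons, List.prod_append, List.prod_singleton,
      Matrix.mul_apply, LinearMap.sum_apply]
    refine Finset.sum_congr rfl fun m _ => ?_
    rw [Module.End.mul_apply, hS]
    have hv : Function.update v 0 (A 0 m j (v 0)) = Fin.cons (A 0 m j (v 0)) (fun n => v n.succ) := by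
      conv_lhs => rw [← Fin.cons_self_tail v]
      rw [Fin.update_cons_zero]
      rfl
    rw [hv]
    refine ih (Φ.curryLeft (A 0 m j (v 0))) (fun n => S n.succ) (fun n => A n.succ) ?_
      (fun n => v n.succ) m
    intro n a b u
    rw [MultilinearMap.curryLeft_apply, MultilinearMap.curryLeft_apply, hS, Fin.cons_update,
      Fin.cons_succ]

end PathSum

namespace Model

variable (P : Model) (sp sm : ℂ)

/-! ### Action of the monodromy matrix on fundamental vectors -/

theorem Lop_tprod {N : ℕ} (n : Fin N) (lam : ℂ) (a b : Fin 2) (v : Fin N → P.V) :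
    P.Lop n lam a b (PiTensorProduct.tprod ℂ v) =
      PiTensorProduct.tprod ℂ (Function.update v n (P.locL lam a b (v n))) := by
  have hsite : ∀ T : Module.End ℂ P.V, P.site n T (PiTensorProduct.tprod ℂ v) =
      PiTensorProduct.tprod ℂ (Function.update v n (T (v n))) := by
    intro T
    unfold site
    rw [PiTensorProduct.map_tprod]
    congr 1
    funext m
    by_cases hm : m = n
    · subst hm; simp
    · simp [hm]
  unfold Lop locL
  rw [LinearMap.sum_apply, LinearMap.sum_apply, MultilinearMap.map_update_sum]
  refine Finset.sum_congr rfl fun c _ => ?_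
  rw [LinearMap.smul_apply, LinearMap.smul_apply, MultilinearMap.map_update_smul, hsite]

theorem twistedMonodromy_apply {N : ℕ} (k k' : ℤ) (lam : ℂ) (i j : Fin 2) (x : P.H N) :
    P.twistedMonodromy sp sm N k k' lam i j x =
      ∑ p, (P.gauge sp sm k lam)⁻¹ i p • ∑ q, P.gauge sp sm k' lam q j •
        P.monodromy N lam p q x := by
  unfold twistedMonodromy scalarMat
  rw [Matrix.mul_apply, LinearMap.sum_apply]
  simp only [Matrix.mul_apply, Matrix.map_apply, Finset.sum_mul, LinearMap.sum_apply,
    Module.End.mul_apply, Module.algebraMap_end_apply, map_smul, Finset.smul_sum]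
  rw [Finset.sum_comm]
  refine Finset.sum_congr rfl fun p _ => Finset.sum_congr rfl fun q _ => ?_
  rw [smul_comm]

variable {N : ℕ}

/-- The face weights of a row of faces between the height sequences `c` and `b`. -/
noncomputable def rowWeight (c b : Fin (N + 1) → ℤ) (lam : ℂ) : ℂ :=
  ∏ j : Fin N, P.W sp sm (c j.succ) (c j.castSucc) (b j.succ) (b j.castSucc) lam

/-- The action of the twisted monodromy matrix on fundamental vectors in terms of face weights. -/
theorem twistedMonodromy_fundamental (hs : ∀ k : ℤ, P.th 1 1 (P.w sp sm k) ≠ 0) {lam : ℂ}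
    (hlam : ∀ k : ℤ, (P.gauge sp sm k lam).det ≠ 0) {c : Fin (N + 1) → ℤ}
    (hc : ∀ j : Fin N, P.Admissible (c j.succ - c j.castSucc)) (e j : Fin 2) :
    P.twistedMonodromy sp sm N (c (Fin.last N)) (c 0) lam e j (P.fundamental sp sm c) =
      ∑ ε : Fin (N + 1) → Fin 2, if ε (Fin.last N) = e ∧ ε 0 = j then
        P.rowWeight sp sm c (fun n => c n + step (ε n)) lam •
          P.fundamental sp sm (fun n => c n + step (ε n)) else 0 := by
  set X : Fin N → Fin 2 → Fin 2 → P.V := fun n a b =>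
    P.W sp sm (c n.succ) (c n.castSucc) (c n.succ + step a) (c n.castSucc + step b) lam •
      P.phi sp sm (c n.succ + step a) (c n.castSucc + step b) 0 with hX
  have hmono : ∀ p q, P.monodromy N lam p q (P.fundamental sp sm c) =
      pathSum (PiTensorProduct.tprod ℂ) (fun n a b =>
        P.locL lam a b (P.phi sp sm (c n.succ) (c n.castSucc) 0)) p q := fun p q =>
    prod_apply_eq_pathSum (PiTensorProduct.tprod ℂ) (fun n => P.Lop n lam)
      (fun _ => P.locL lam) (fun n a b v => P.Lop_tprod n lam a b v) _ p q
  have hg := fun p => pathSum_gauge (fun n => P.gauge sp sm (c n) lam)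
    (fun n a b => P.locL lam a b (P.phi sp sm (c n.succ) (c n.castSucc) 0)) X
    (fun n a b => P.locL_gauge sp sm (hc n) (hs _) (hs _) (hlam _) a b)
    (PiTensorProduct.tprod ℂ) p j
  have hinv : (P.gauge sp sm (c (Fin.last N)) lam)⁻¹ * P.gauge sp sm (c (Fin.last N)) lam = 1 :=
    Matrix.nonsing_inv_mul _ (Ne.isUnit (hlam _))
  have hpath : P.twistedMonodromy sp sm N (c (Fin.last N)) (c 0) lam e j
      (P.fundamental sp sm c) = pathSum (PiTensorProduct.tprod ℂ) X e j := by
    rw [twistedMonodromy_apply]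
    simp only [hmono, hg, Finset.smul_sum, smul_smul]
    rw [Finset.sum_comm]
    simp only [← Finset.sum_smul, ← Matrix.mul_apply, hinv, Matrix.one_apply]
    simp
  rw [hpath, pathSum]
  refine Finset.sum_congr rfl fun ε _ => ?_
  split_ifs
  · rw [hX, MultilinearMap.map_smul_univ]
    rfl
  · rfl

/-! ### Summation over height configurations -/

/-- For inadmissible neighbouring heights `phi` is `0` by convention, so such height sequences do not
contribute to sums of fundamental vectors. -/
theorem fundamental_eq_zero {b : Fin (N + 1) → ℤ}
    (hb : ¬ ∀ j : Fin N, P.Admissible (b j.succ - b j.castSucc)) : P.fundamental sp sm b = 0 := by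
  rw [not_forall] at hb
  obtain ⟨j, hj⟩ := hb
  refine (PiTensorProduct.tprod ℂ).map_coord_zero j ?_
  exact dif_neg hj

/-- The admissible height sequences which differ from `c` by `±1` everywhere, by `+1` at the right
end and by `-1` at the left end of the chain. -/
def rowStepSet (c : Fin (N + 1) → ℤ) : Set (Fin (N + 1) → ℤ) :=
  {b | (∀ j, c j - b j = 1 ∨ c j - b j = -1) ∧
    (∀ j : Fin N, P.Admissible (b j.succ - b j.castSucc)) ∧
    b (Fin.last N) = c (Fin.last N) - 1 ∧ b 0 = c 0 + 1}

theorem rowStepSet_finite (c : Fin (N + 1) → ℤ) : (P.rowStepSet c).Finite := by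
  refine (Set.Finite.pi' fun j : Fin (N + 1) => Set.finite_Icc (c j - 1) (c j + 1)).subset ?_
  rintro b ⟨h, -⟩ j
  have := h j
  constructor <;> omega

theorem sub_add_step (m : ℤ) (x : Fin 2) : m - (m + step x) = 1 ∨ m - (m + step x) = -1 := by
  fin_cases x <;> simp [step]

theorem ite_add_step (m : ℤ) (x : Fin 2) :
    (if m + step x = m + 1 then (1 : Fin 2) else 0) = x := by
  fin_cases x <;> simp [step]

/-- The action of `B_{k,k'}(λ)` on the fundamental vector of a height sequence running from `k'`
to `k`. -/
theorem B_fundamental (hs : ∀ k : ℤ, P.th 1 1 (P.w sp sm k) ≠ 0) {lam : ℂ}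
    (hlam : ∀ k : ℤ, (P.gauge sp sm k lam).det ≠ 0) {c : Fin (N + 1) → ℤ}
    (hc : ∀ j : Fin N, P.Admissible (c j.succ - c j.castSucc)) {k k' : ℤ}
    (hk : c (Fin.last N) = k) (hk' : c 0 = k') :
    P.B sp sm N k k' lam (P.fundamental sp sm c) =
      ∑ b ∈ (P.rowStepSet_finite c).toFinset,
        P.rowWeight sp sm c b lam • P.fundamental sp sm b := by
  classical
  subst hk hk'
  rw [B, P.twistedMonodromy_fundamental sp sm hs hlam hc, ← Finset.sum_filter]
  symm
  -- A sequence of steps is recovered from `b` as the sequence of signs of `b - c`.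
  refine Finset.sum_of_injOn (fun b n => if b n = c n + 1 then 1 else 0) ?_ ?_ ?_ ?_
  · intro b hb b' hb' h
    simp only [Set.Finite.coe_toFinset] at hb hb'
    funext n
    have h1 := hb.1 n
    have h2 := hb'.1 n
    have h3 := congrFun h n
    simp only at h3
    split_ifs at h3 <;> omega
  · intro b hb
    simp only [Set.Finite.coe_toFinset] at hb
    obtain ⟨-, -, h3, h4⟩ := hb
    simp only [Finset.coe_filter, Finset.mem_univ, true_and, Set.mem_ofPred_eq]
    constructor
    · rw [if_neg (by omega)]
    · rw [if_pos h4]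
  · intro ε hε hn
    rw [P.fundamental_eq_zero sp sm, smul_zero]
    intro hadm
    refine hn ⟨fun n => c n + step (ε n), ?_, ?_⟩
    · simp only [Finset.mem_filter, Finset.mem_univ, true_and] at hε
      simp only [Set.Finite.coe_toFinset]
      refine ⟨fun j => sub_add_step _ _, hadm, ?_, ?_⟩
      · simp only [hε.1]; rfl
      · simp only [hε.2]; rfl
    · exact funext fun n => ite_add_step _ _
  · intro b hb
    rw [Set.Finite.mem_toFinset] at hb
    have : (fun n => c n + step (if b n = c n + 1 then 1 else 0)) = b := by
      funext n
      have := hb.1 n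
      split_ifs with h
      · rw [h]; rfl
      · change c n + -1 = b n
        omega
    rw [this]

/-- Height configurations with `M + 1` rows, last row `d`, and linearly moving ends starting from
`q` (left) and `p` (right). The first row is not prescribed. -/
def openConfigSet (N M : ℕ) (p q : ℤ) (d : Fin (N + 1) → ℤ) :
    Set (Fin (M + 1) → Fin (N + 1) → ℤ) :=
  {c | (∀ (i : Fin M) (j : Fin (N + 1)),
          c i.succ j - c i.castSucc j = 1 ∨ c i.succ j - c i.castSucc j = -1) ∧
       (∀ (i : Fin (M + 1)) (j : Fin N), P.Admissible (c i j.succ - c i j.castSucc)) ∧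
       (∀ j, c (Fin.last M) j = d j) ∧
       (∀ i : Fin (M + 1), c i 0 = q - (i : ℕ)) ∧
       (∀ i : Fin (M + 1), c i (Fin.last N) = p + (i : ℕ))}

theorem openConfigSet_finite (N M : ℕ) (p q : ℤ) (d : Fin (N + 1) → ℤ) :
    (P.openConfigSet N M p q d).Finite := by
  refine (Set.Finite.pi' fun i : Fin (M + 1) => Set.Finite.pi' fun _ : Fin (N + 1) =>
    Set.finite_Icc (q - (i : ℕ) - P.L * N) (q - (i : ℕ) + P.L * N)).subset ?_
  rintro c ⟨-, h, -, h0, -⟩ i j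
  have := P.abs_sub_le_of_admissible (h i) j
  rw [h0] at this
  exact this

/-- Removing the first row of a configuration moves the prescribed ends by one. -/
theorem cons_mem_openConfigSet {M : ℕ} {p q : ℤ} {d : Fin (N + 1) → ℤ}
    {c : Fin (M + 1) → Fin (N + 1) → ℤ} {b : Fin (N + 1) → ℤ} :
    (Fin.cons b c : Fin (M + 2) → Fin (N + 1) → ℤ) ∈ P.openConfigSet N (M + 1) p q d ↔
      c ∈ P.openConfigSet N M (p + 1) (q - 1) d ∧ b ∈ P.rowStepSet (c 0) := by
  constructor
  · rintro ⟨h1, h2, h3, h4, h5⟩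
    have e0 := h4 0
    have e1 := h4 1
    have f0 := h5 0
    have f1 := h5 1
    simp only [Fin.cons_zero, Fin.val_zero, Nat.cast_zero] at e0 f0
    change c 0 0 = _ at e1
    change c 0 (Fin.last N) = _ at f1
    simp only [Fin.val_one, Nat.cast_one] at e1 f1
    refine ⟨⟨fun i j => h1 i.succ j, fun i j => h2 i.succ j, fun j => h3 j, fun i => ?_,
      fun i => ?_⟩, fun j => h1 0 j, fun j => h2 0 j, ?_, ?_⟩
    · have := h4 i.succ
      rw [Fin.cons_succ, Fin.val_succ] at this
      rw [this]; push_cast; ring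
    · have := h5 i.succ
      rw [Fin.cons_succ, Fin.val_succ] at this
      rw [this]; push_cast; ring
    · omega
    · omega
  · rintro ⟨⟨h1, h2, h3, h4, h5⟩, k1, k2, k3, k4⟩
    have e0 := h4 0
    have f0 := h5 0
    simp only [Fin.val_zero, Nat.cast_zero] at e0 f0
    refine ⟨fun i j => ?_, fun i j => ?_, fun j => h3 j, fun i => ?_, fun i => ?_⟩
    · refine Fin.cases ?_ (fun i => ?_) i
      · exact k1 j
      · exact h1 i j
    · refine Fin.cases ?_ (fun i => ?_) i
      · exact k2 j
      · exact h2 i j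
    · refine Fin.cases ?_ (fun i => ?_) i
      · simp only [Fin.cons_zero, Fin.val_zero, Nat.cast_zero]; omega
      · rw [Fin.cons_succ, Fin.val_succ, h4 i]; push_cast; ring
    · refine Fin.cases ?_ (fun i => ?_) i
      · simp only [Fin.cons_zero, Fin.val_zero, Nat.cast_zero]; omega
      · rw [Fin.cons_succ, Fin.val_succ, h5 i]; push_cast; ring

/-- A product of operators `B` applied to a fundamental vector, as a partition function. -/
theorem prod_B_fundamental (hs : ∀ k : ℤ, P.th 1 1 (P.w sp sm k) ≠ 0) {M : ℕ} {lam : Fin M → ℂ}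
    (hlam : ∀ (i : Fin M) (k : ℤ), (P.gauge sp sm k (lam i)).det ≠ 0) {p q : ℤ}
    {d : Fin (N + 1) → ℤ} (hd : ∀ j : Fin N, P.Admissible (d j.succ - d j.castSucc))
    (hd0 : d 0 = q - M) (hdN : d (Fin.last N) = p + M) :
    (List.ofFn fun i : Fin M => P.B sp sm N (p + ((i : ℕ) + 1)) (q - ((i : ℕ) + 1)) (lam i)).prod
        (P.fundamental sp sm d) =
      ∑ c ∈ (P.openConfigSet_finite N M p q d).toFinset,
        (∏ i : Fin M, P.rowWeight sp sm (c i.succ) (c i.castSucc) (lam i)) •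
          P.fundamental sp sm (c 0) := by
  induction M generalizing p q with
  | zero =>
    have : (P.openConfigSet_finite N 0 p q d).toFinset = {fun _ => d} := by
      ext c
      simp only [Set.Finite.mem_toFinset, Finset.mem_singleton]
      constructor
      · rintro ⟨-, -, h, -⟩
        funext i j
        rw [Fin.eq_zero i]
        exact h j
      · rintro rfl
        refine ⟨fun i => i.elim0, fun _ => hd, fun _ => rfl, fun i => ?_, fun i => ?_⟩
        · rw [Fin.eq_zero i]; exact hd0
        · rw [Fin.eq_zero i]; exact hdN
    rw [this]
    simp
  | succ M ih =>
    have hcast : ∀ i : Fin M,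
        P.B sp sm N (p + ((i.succ : ℕ) + 1)) (q - ((i.succ : ℕ) + 1)) (lam i.succ) =
          P.B sp sm N (p + 1 + ((i : ℕ) + 1)) (q - 1 - ((i : ℕ) + 1)) (lam i.succ) := by
      intro i
      congr 1 <;> rw [Fin.val_succ] <;> push_cast <;> ring
    rw [List.ofFn_succ, List.prod_cons, Module.End.mul_apply]
    simp only [hcast]
    rw [ih (fun i => hlam i.succ) (by rw [hd0]; push_cast; ring) (by rw [hdN]; push_cast; ring),
      map_sum]
    have hB : ∀ c ∈ (P.openConfigSet_finite N M (p + 1) (q - 1) d).toFinset,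
        P.B sp sm N (p + (((0 : Fin (M + 1)) : ℕ) + 1)) (q - (((0 : Fin (M + 1)) : ℕ) + 1)) (lam 0)
          ((∏ i : Fin M, P.rowWeight sp sm (c i.succ) (c i.castSucc) (lam i.succ)) •
            P.fundamental sp sm (c 0)) =
        ∑ b ∈ (P.rowStepSet_finite (c 0)).toFinset,
          ((∏ i : Fin M, P.rowWeight sp sm (c i.succ) (c i.castSucc) (lam i.succ)) *
            P.rowWeight sp sm (c 0) b (lam 0)) • P.fundamental sp sm b := by
      intro c hc
      rw [Set.Finite.mem_toFinset] at hc
      obtain ⟨-, h2, -, h4, h5⟩ := hc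
      rw [map_smul, P.B_fundamental sp sm hs (hlam 0) (h2 0) (by rw [h5]; simp) (by rw [h4]; simp),
        Finset.smul_sum]
      simp only [smul_smul]
    rw [Finset.sum_congr rfl hB, Finset.sum_sigma']
    refine Finset.sum_bij' (fun x _ => Fin.cons x.2 x.1) (fun c _ => ⟨Fin.tail c, c 0⟩)
      ?_ ?_ ?_ ?_ ?_
    · rintro ⟨c, b⟩ h
      simpa only [Finset.mem_sigma, Set.Finite.mem_toFinset, cons_mem_openConfigSet] using h
    · intro c h
      rw [← Fin.cons_self_tail c] at h
      simpa only [Finset.mem_sigma, Set.Finite.mem_toFinset, cons_mem_openConfigSet] using h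
    · rintro ⟨c, b⟩ _
      rfl
    · intro c _
      exact Fin.cons_self_tail c
    · rintro ⟨c, b⟩ _
      rw [Fin.prod_univ_succ, mul_comm]
      rfl

theorem vacuum_eq (a : ℤ) :
    P.vacuum sp sm N a = P.fundamental sp sm fun j : Fin (N + 1) => a + P.L * (j : ℕ) := rfl

theorem configs_eq_filter (N M : ℕ) (a : ℤ) (b : Fin (N + 1) → ℤ) :
    P.configs N M a b = {c ∈ (P.openConfigSet_finite N M a a
      fun j : Fin (N + 1) => a - M + P.L * (j : ℕ)).toFinset | c 0 = b} := by
  ext c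
  rw [configs, Set.Finite.mem_toFinset, Finset.mem_filter, Set.Finite.mem_toFinset]
  constructor
  · rintro ⟨h1, h2, h3, h4, h5, h6⟩
    exact ⟨⟨h1, h2, h4, h5, h6⟩, funext h3⟩
  · rintro ⟨⟨h1, h2, h4, h5, h6⟩, h3⟩
    exact ⟨h1, h2, congrFun h3, h4, h5, h6⟩

end Model
end EightVertex

theorem mainTheorem3 (P : EightVertex.Model) (N M : ℕ) (hM : 2 * M = N * P.L) (sp sm : ℂ)
    (hs : ∀ k : ℤ, P.th 1 1 (P.w sp sm k) ≠ 0) (ν : ℤ) (lam : Fin M → ℂ)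
    (hlam : ∀ (i : Fin M) (k : ℤ), (P.gauge sp sm k (lam i)).det ≠ 0) :
    P.bethe sp sm N ν lam =
      ∑ a ∈ Finset.range P.r, Complex.exp (2 * Real.pi * Complex.I * ν * P.η * a) •
        ∑ b ∈ P.paths N a,
          (∑ c ∈ P.configs N M a b, ∏ i : Fin M, ∏ j : Fin N,
            P.W sp sm (c i.succ j.succ) (c i.succ j.castSucc)
              (c i.castSucc j.succ) (c i.castSucc j.castSucc) (lam i)) •
          P.fundamental sp sm b := by
  unfold EightVertex.Model.bethe
  refine Finset.sum_congr rfl fun a _ => congrArg _ ?_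
  have hM' : (2 * M : ℤ) = N * P.L := by exact_mod_cast hM
  -- The pseudo vacuum is the fundamental vector of the last row of the configurations.
  unfold EightVertex.Model.PhiVec
  rw [P.vacuum_eq, P.prod_B_fundamental sp sm hs hlam (fun j => ⟨P.L, le_rfl, by
      rw [Fin.val_succ, Fin.val_castSucc]; push_cast; ring⟩) (by simp)
      (by rw [Fin.val_last]; linear_combination -hM'),
    ← Finset.sum_fiberwise_of_maps_to (t := P.paths N a) (g := fun c => c 0)]
  · refine Finset.sum_congr rfl fun b _ => ?_
    rw [P.configs_eq_filter, Finset.sum_smul]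
    refine Finset.sum_congr rfl fun c hc => ?_
    rw [(Finset.mem_filter.1 hc).2]
    rfl
  · intro c hc
    rw [Set.Finite.mem_toFinset] at hc
    obtain ⟨-, h2, -, h4, h5⟩ := hc
    rw [EightVertex.Model.paths, Set.Finite.mem_toFinset]
    exact ⟨by rw [h4]; simp, by rw [h5]; simp, h2 0⟩
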